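/- Let $\mathcal O$ be a complete discrete valuation ring of characteristic $0$ with finite residue field $k$ of cardinality $q=p^h$, $p$ prime, let $\pi$ be a uniformizing parameter of $\mathcal O$ and let $e$ be the absolute ramification index of $\mathcal O$, i.e. $p$ has valuation $e$. Put $\mathcal O_0=W(k)$, the ring of $p$-typical Witt vectors, with uniformizing parameter $p$, embedded canonically in $\mathcal O$. For an $\mathcal O$-algebra $B$ let $W_{\mathcal O}(B)$ be the $\mathcal O$-algebra of ramified Witt vectors: the set $B^{\mathbb N_0}$ with the functorial $\mathcal O$-algebra structure for which the maps $\Phi_n(b)=b_0^{q^n}+\pi b_1^{q^{n-1}}+\dots+\pi^n b_n$ are homomorphisms of $\mathcal O$-algebras; similarly $W_{\mathcal O_0}$, with $p$ in place of $\pi$. For an extension $\mathcal O'$ of $\mathcal O$ with residue extension of degree $f$, let $u_{(\mathcal O,\mathcal O')}\colon W_{\mathcal O}(B)\to W_{\mathcal O'}(B)$ be the Drinfeld map, i.e. the homomorphism, functorial in the $\mathcal O'$-algebra $B$, with $\Phi'_n(u(b))=\Phi_{fn}(b)$; recall that $W_{\mathbb Z_p}(B)=W(B)$. We regard $W$, $W_{\mathcal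 O_0}$ and $W_{\mathcal O}$ as $k$-ring schemes by restricting them to $k$-algebras $A$ (special fibres). Let $\mathbb R_{\mathcal O}$ be the Greenberg algebra of $\mathcal O$, the $k$-ring scheme with $\mathbb R_{\mathcal O}(A)=W(A)\otimes_{W(k)}\mathcal O$, and let $\boldsymbol r\colon \mathbb R_{\mathcal O}\to \mathbb W_{\mathcal O,k}$ be the morphism of $k$-ring schemes given on $A$-sections by the $\mathcal O$-linear extension of $u_{(\mathbb Z_p,\mathcal O)}\colon W(A)\to W_{\mathcal O}(A)$. Let $\boldsymbol u_k$ denote $u_{(\mathbb Z_p,\mathcal O_0)}$ on $k$-algebras, and let $\boldsymbol u^{\rm ra}_k$ be the morphism given by the $\mathcal O$-linear extension $W_{\mathcal O_0}(A)\otimes_{\mathcal O_0}\mathcal O\to W_{\mathcal O}(A)$ of $u_{(\mathcal O_0,\mathcal O)}$. Isomorphisms with a spectrum are isomorphisms of $k$-schemes. (a) If $\mathcal O\cong W(k)$, then $W(A)\to W(A)\otimes_{W(k)}\mathcal O$, $x\mapsto x\otimes 1$, is an isomorphism $\mathbb W_k\cong\mathbb R_{\mathcal O}$, under which $\boldsymbol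 r$ is $u_{(\mathbb Z_p,\mathcal O)}$ on $k$-algebras, and $$\ker \boldsymbol r\cong \mathrm{Spec}\bigl(k[X_0,X_1,\dots]/(X_0,\dots,X_i^{p^{i(h-1)}},\dots)\bigr).$$ (b) If $k\cong\mathbb F_p$, then, under the isomorphism $W(A)\otimes_{W(k)}\mathcal O\cong W_{\mathcal O_0}(A)\otimes_{\mathcal O_0}\mathcal O$ induced by the identity on Witt components, $\boldsymbol r=\boldsymbol u^{\rm ra}_k$, and $$\ker \boldsymbol r\cong \mathrm{Spec}\bigl(k[X_{n,i};\,n\in\mathbb N_0,\,0\le i<e]/(X_{n,i}^{p^{n(e-1)+i}})\bigr).$$ (c) In general, there is an exact sequence of commutative affine $k$-group schemes (for the fpqc topology) $$0\to \prod_{i=0}^{e-1}\ker \boldsymbol u_k\to \ker\boldsymbol r\to \ker \boldsymbol u^{\rm ra}_k\to 0,$$ where $\ker\boldsymbol u_k$ and $\ker\boldsymbol u^{\rm ra}_k$ are pro-infinitesimal (cofiltered limits of finite local $k$-group schemes) and, as $k$-schemes, $\ker \boldsymbol u_k\cong \mathrm{Spec}(k[X_0,X_1,\dots]/(X_i^{p^{i(h-1)}};\,i\ge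 0))$ and $\ker\boldsymbol u^{\rm ra}_k\cong\mathrm{Spec}(k[X_{n,i};\,n\in\mathbb N_0,\,0\le i<e]/(X_{n,i}^{q^{n(e-1)+i}}))$. -/

import Mathlib

open CategoryTheory

universe u

namespace RamifiedWitt

/-! ## Ramified Witt vectors -/

/-- Data over which ramified Witt vectors are formed: an element `ϖ` of `R` (the uniformizing
parameter) and `q = p ^ f` such that `ϖ` is not a zero divisor, `ϖ ∣ p`, and `x ^ q ≡ x mod ϖ`.
The cases used are a discrete valuation ring with residue field of cardinality `q`, the ring
`W(k)` with `ϖ = p`, and `ℤ` with `ϖ = q = p` (the `p`-typical case). -/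
structure WittDatum (R : Type*) [CommRing R] (p : ℕ) where
  ϖ : R
  f : ℕ
  f_pos : 0 < f
  regular : ∀ x : R, ϖ * x = 0 → x = 0
  dvd_p : ϖ ∣ (p : R)
  frob : ∀ x : R, ϖ ∣ x ^ (p ^ f) - x

/-- The cardinality `q`. -/
def WittDatum.q {R : Type*} [CommRing R] {p : ℕ} (D : WittDatum R p) : ℕ := p ^ D.f

/-- The Witt polynomial `Φ_n = x_0^{q^n} + a x_1^{q^{n-1}} + ⋯ + a^n x_n`, evaluated in a ring. -/
def wittPoly {B : Type*} [CommRing B] (q : ℕ) (a : B) (n : ℕ) (x : ℕ → B) : B :=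
  ∑ i ∈ Finset.range (n + 1), a ^ i * x i ^ q ^ (n - i)

theorem map_wittPoly {B B' : Type*} [CommRing B] [CommRing B'] (ψ : B →+* B') (q : ℕ) (a : B)
    (n : ℕ) (x : ℕ → B) :
    ψ (wittPoly q a n x) = wittPoly q (ψ a) n (fun i => ψ (x i)) := by
  simp [wittPoly]

theorem wittPoly_succ {B : Type*} [CommRing B] (q : ℕ) (a : B) (n : ℕ) (x : ℕ → B) :
    wittPoly q a (n + 1) x = wittPoly q a n (fun i => x i ^ q) + a ^ (n + 1) * x (n + 1) := by
  unfold wittPoly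
  rw [Finset.sum_range_succ]
  congr 1
  · refine Finset.sum_congr rfl fun i hi => ?_
    have : n + 1 - i = (n - i) + 1 := by
      have := Finset.mem_range.1 hi
      omega
    rw [this, ← pow_mul, pow_succ, mul_comm q]
  · simp

open Classical in
/-- Some `c` with `b = a * c`, if there is one. -/
noncomputable def quot {B : Type*} [CommRing B] (a b : B) : B :=
  if h : a ∣ b then h.choose else 0

theorem mul_quot {B : Type*} [CommRing B] {a b : B} (h : a ∣ b) : a * quot a b = b := by
  rw [quot, dif_pos h]
  exact h.choose_spec.symm

/-- The solution `x` of the equations `Φ_n(x) = g n`, computed recursively. -/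
noncomputable def solve {B : Type*} [CommRing B] (q : ℕ) (a : B) (g : ℕ → B) : ℕ → B
  | n => quot (a ^ n) (g n - ∑ i : Fin n, a ^ (i : ℕ) * solve q a g i ^ q ^ (n - (i : ℕ)))
termination_by n => n

theorem dvd_pow_sub_pow {B : Type*} [CommRing B] {q : ℕ} {a : B} (ha : a ∣ (q : B)) {x y : B}
    (h : a ∣ x - y) (n : ℕ) : a ^ (n + 1) ∣ x ^ q ^ n - y ^ q ^ n := by
  induction n with
  | zero => simpa using h
  | succ n ih =>
    rw [pow_succ q n, pow_mul, pow_mul, ← (Commute.all _ _).geom_sum₂_mul, mul_comm,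
      pow_succ a (n + 1)]
    refine mul_dvd_mul ih ?_
    exact (dvd_geom_sum₂_iff_of_dvd_sub ((dvd_pow_self a n.succ_ne_zero).trans ih)).2
      (ha.mul_right _)

/-- If `σ` lifts the `q`-Frobenius modulo `a` and fixes `a`, then `σ (g n) ≡ g (n + 1)` modulo
`a ^ (n + 1)` for all `n` suffices for `g` to be a sequence of values of Witt polynomials. -/
theorem wittPoly_solve {B : Type*} [CommRing B] {q : ℕ} {a : B} (ha : a ∣ (q : B))
    (σ : B →+* B) (hσa : σ a = a) (hσ : ∀ b, a ∣ σ b - b ^ q) (g : ℕ → B)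
    (hg : ∀ n, a ^ (n + 1) ∣ σ (g n) - g (n + 1)) (n : ℕ) :
    wittPoly q a n (solve q a g) = g n := by
  induction n using Nat.strong_induction_on with
  | _ n ih =>
    have key : a ^ n ∣ g n - ∑ i : Fin n, a ^ (i : ℕ) * solve q a g i ^ q ^ (n - (i : ℕ)) := by
      rw [Fin.sum_univ_eq_sum_range (fun i => a ^ i * solve q a g i ^ q ^ (n - i))]
      cases n with
      | zero => simp
      | succ m =>
        have h1 : g (m + 1) - ∑ i ∈ Finset.range (m + 1),
              a ^ i * solve q a g i ^ q ^ (m + 1 - i)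
            = -(σ (g m) - g (m + 1)) + ∑ i ∈ Finset.range (m + 1),
              a ^ i * (σ (solve q a g i) ^ q ^ (m - i) - (solve q a g i ^ q) ^ q ^ (m - i)) := by
          rw [← ih m (Nat.lt_succ_self m), map_wittPoly, wittPoly, hσa]
          simp only [mul_sub, Finset.sum_sub_distrib]
          have : ∑ i ∈ Finset.range (m + 1), a ^ i * solve q a g i ^ q ^ (m + 1 - i)
              = ∑ i ∈ Finset.range (m + 1), a ^ i * (solve q a g i ^ q) ^ q ^ (m - i) := by
            refine Finset.sum_congr rfl fun i hi => ?_
            have : m + 1 - i = (m - i) + 1 := by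
              have := Finset.mem_range.1 hi
              omega
            rw [this, ← pow_mul, pow_succ, mul_comm q]
          rw [this]
          ring
        rw [h1]
        refine dvd_add ((hg m).neg_right) (Finset.dvd_sum fun i hi => ?_)
        have hi' : m + 1 = i + (m - i + 1) := by
          have := Finset.mem_range.1 hi
          omega
        rw [hi', pow_add]
        refine mul_dvd_mul_left _ ?_
        exact dvd_pow_sub_pow ha (hσ (solve q a g i)) (m - i)
    rw [wittPoly, Finset.sum_range_succ, Nat.sub_self, pow_zero, pow_one]
    conv_lhs => rw [solve]
    rw [mul_quot key, Fin.sum_univ_eq_sum_range (fun i => a ^ i * solve q a g i ^ q ^ (n - i))]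
    ring

theorem wittPoly_injective {B : Type*} [CommRing B] {q : ℕ} {a : B}
    (ha : ∀ x, a * x = 0 → x = 0) {x y : ℕ → B}
    (h : ∀ n, wittPoly q a n x = wittPoly q a n y) : x = y := by
  have hreg : ∀ n x, a ^ n * x = 0 → x = 0 := by
    intro n
    induction n with
    | zero => simp
    | succ n ih =>
      intro x hx
      rw [pow_succ, mul_assoc] at hx
      exact ha _ (ih _ hx)
  funext n
  induction n using Nat.strong_induction_on with
  | _ n ih =>
    have := h n
    rw [wittPoly, wittPoly, Finset.sum_range_succ, Finset.sum_range_succ,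
      Finset.sum_congr rfl fun i hi => by rw [ih i (Finset.mem_range.1 hi)]] at this
    simp only [Nat.sub_self, pow_zero, pow_one, add_right_inj] at this
    exact sub_eq_zero.1 (hreg n _ (by rw [mul_sub, this, sub_self]))

variable {R : Type*} [CommRing R] {p : ℕ} (D : WittDatum R p)

namespace WittDatum

theorem dvd_q : D.ϖ ∣ (D.q : R) := by
  rw [q, Nat.cast_pow]
  exact D.dvd_p.trans (dvd_pow_self _ D.f_pos.ne')

section Polynomial

variable {σ : Type*}

theorem C_dvd_q : (MvPolynomial.C D.ϖ : MvPolynomial σ R) ∣ (D.q : MvPolynomial σ R) := by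
  have := map_dvd (MvPolynomial.C (σ := σ)) D.dvd_q
  rwa [map_natCast] at this

theorem C_regular (x : MvPolynomial σ R) (h : MvPolynomial.C D.ϖ * x = 0) : x = 0 := by
  ext m
  rw [MvPolynomial.coeff_zero]
  refine D.regular _ ?_
  rw [← MvPolynomial.coeff_C_mul, h, MvPolynomial.coeff_zero]

theorem C_dvd_expand [Fact p.Prime] (b : MvPolynomial σ R) :
    MvPolynomial.C D.ϖ ∣ MvPolynomial.expand D.q b - b ^ D.q := by
  induction b using MvPolynomial.induction_on with
  | C a =>
    rw [MvPolynomial.expand_C, ← map_pow, ← map_sub]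
    refine map_dvd _ ?_
    rw [← neg_sub]
    exact (D.frob a).neg_right
  | add x y hx hy =>
    obtain ⟨r, hr⟩ := exists_add_pow_prime_pow_eq (Fact.out : p.Prime) x y D.f
    have h : MvPolynomial.expand D.q (x + y) - (x + y) ^ D.q
        = (MvPolynomial.expand D.q x - x ^ D.q) + (MvPolynomial.expand D.q y - y ^ D.q)
          - p * (x * y * r) := by
      rw [map_add]
      simp only [q] at *
      rw [hr]
      ring
    rw [h]
    refine dvd_sub (dvd_add hx hy) (Dvd.dvd.mul_right ?_ _)
    have := map_dvd (MvPolynomial.C (σ := σ)) D.dvd_p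
    rwa [map_natCast] at this
  | mul_X x i hx =>
    rw [map_mul, MvPolynomial.expand_X, mul_pow, ← sub_mul]
    exact hx.mul_right _

/-- The sequences of polynomials that are values of the Witt polynomials. -/
def Good (g : ℕ → MvPolynomial σ R) : Prop :=
  ∀ n, MvPolynomial.C D.ϖ ^ (n + 1) ∣ MvPolynomial.expand D.q (g n) - g (n + 1)

/-- The polynomials `S_n` with `Φ_n(S_0, …, S_n) = g n`. -/
noncomputable def structurePoly (g : ℕ → MvPolynomial σ R) : ℕ → MvPolynomial σ R :=
  solve D.q (MvPolynomial.C D.ϖ) g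

theorem wittPoly_structurePoly [Fact p.Prime] {g : ℕ → MvPolynomial σ R} (hg : D.Good g) (n : ℕ) :
    wittPoly D.q (MvPolynomial.C D.ϖ) n (D.structurePoly g) = g n :=
  wittPoly_solve D.C_dvd_q (MvPolynomial.expand D.q : MvPolynomial σ R →ₐ[R] _).toRingHom
    (MvPolynomial.expand_C _ _) D.C_dvd_expand g hg n

theorem good_wittPoly [Fact p.Prime] (x : ℕ → MvPolynomial σ R)
    (hx : ∀ i, MvPolynomial.expand D.q (x i) = x i ^ D.q) :
    D.Good fun n => wittPoly D.q (MvPolynomial.C D.ϖ) n x := by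
  intro n
  have h : MvPolynomial.expand D.q (wittPoly D.q (MvPolynomial.C D.ϖ) n x)
      = wittPoly D.q (MvPolynomial.C D.ϖ) n fun i => x i ^ D.q := by
    have := map_wittPoly (MvPolynomial.expand D.q : MvPolynomial σ R →ₐ[R] _).toRingHom D.q
      (MvPolynomial.C D.ϖ) n x
    refine this.trans ?_
    congr 1
    · exact MvPolynomial.expand_C _ _
    · exact funext hx
  beta_reduce
  rw [wittPoly_succ, h, sub_add_cancel_left]
  exact (dvd_mul_right _ _).neg_right

variable {D}

theorem Good.add {g g' : ℕ → MvPolynomial σ R} (hg : D.Good g) (hg' : D.Good g') :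
    D.Good (g + g') := fun n => by
  rw [Pi.add_apply, Pi.add_apply, map_add, add_sub_add_comm]
  exact dvd_add (hg n) (hg' n)

theorem Good.neg {g : ℕ → MvPolynomial σ R} (hg : D.Good g) : D.Good (-g) := fun n => by
  rw [Pi.neg_apply, Pi.neg_apply, map_neg, neg_sub_neg, ← neg_sub]
  exact (hg n).neg_right

theorem Good.mul {g g' : ℕ → MvPolynomial σ R} (hg : D.Good g) (hg' : D.Good g') :
    D.Good (g * g') := fun n => by
  have h : MvPolynomial.expand D.q ((g * g') n) - (g * g') (n + 1)
      = (MvPolynomial.expand D.q (g n) - g (n + 1)) * MvPolynomial.expand D.q (g' n)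
        + g (n + 1) * (MvPolynomial.expand D.q (g' n) - g' (n + 1)) := by
    rw [Pi.mul_apply, Pi.mul_apply, map_mul]
    ring
  rw [h]
  exact dvd_add ((hg n).mul_right _) ((hg' n).mul_left _)

theorem good_C (r : R) : D.Good fun _ => (MvPolynomial.C r : MvPolynomial σ R) := fun n => by
  simp

end Polynomial

end WittDatum

/-- The set `B^{ℕ}` of ramified Witt vectors with coefficients in the `R`-algebra `φ : R → B`. -/
@[ext]
structure RamWitt {B : Type*} [CommRing B] (D : WittDatum R p) (φ : R →+* B) where
  coeff : ℕ → B

namespace RamWitt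

variable {D} {B B' : Type*} [CommRing B] [CommRing B'] {φ : R →+* B} {φ' : R →+* B'}

/-- `Φ_n(b) = b_0^{q^n} + ϖ b_1^{q^{n-1}} + ⋯ + ϖ^n b_n`. -/
def ghost (n : ℕ) (b : RamWitt D φ) : B := wittPoly D.q (φ D.ϖ) n b.coeff

/-- Coefficientwise application of a homomorphism of `R`-algebras. -/
def mapFun (ψ : B →+* B') (_h : ψ.comp φ = φ') (b : RamWitt D φ) : RamWitt D φ' :=
  ⟨fun n => ψ (b.coeff n)⟩

/-- The vector obtained from the structure polynomials for `g` by substituting `x`. -/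
noncomputable def eval {σ : Type*} (g : ℕ → MvPolynomial σ R) (x : σ → B) : RamWitt D φ :=
  ⟨fun n => MvPolynomial.eval₂ φ x (D.structurePoly g n)⟩

theorem ghost_eval [Fact p.Prime] {σ : Type*} {g : ℕ → MvPolynomial σ R} (hg : D.Good g)
    (x : σ → B) (n : ℕ) : ghost n (eval g x : RamWitt D φ) = MvPolynomial.eval₂ φ x (g n) := by
  rw [← D.wittPoly_structurePoly hg n]
  have := map_wittPoly (MvPolynomial.eval₂Hom φ x) D.q (MvPolynomial.C D.ϖ) n (D.structurePoly g)
  rw [MvPolynomial.eval₂Hom_C] at this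
  exact this.symm

theorem mapFun_eval {σ : Type*} (g : ℕ → MvPolynomial σ R) (x : σ → B) (ψ : B →+* B')
    (h : ψ.comp φ = φ') :
    mapFun ψ h (eval g x : RamWitt D φ) = eval g fun i => ψ (x i) := by
  ext n
  subst h
  exact MvPolynomial.hom_eval₂ _ _ _ _

theorem ghost_mapFun (ψ : B →+* B') (h : ψ.comp φ = φ') (b : RamWitt D φ) (n : ℕ) :
    ghost n (mapFun ψ h b) = ψ (ghost n b) := by
  subst h
  exact (map_wittPoly ψ _ _ _ _).symm

/-- The polynomials `Φ_n` in the variables `X_{i,0}, X_{i,1}, …`. -/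
noncomputable def wittX (D : WittDatum R p) {ι : Type*} (i : ι) (n : ℕ) : MvPolynomial (ι × ℕ) R :=
  wittPoly D.q (MvPolynomial.C D.ϖ) n fun m => MvPolynomial.X (i, m)

theorem good_wittX [Fact p.Prime] (D : WittDatum R p) {ι : Type*} (i : ι) : D.Good (wittX D i) :=
  D.good_wittPoly _ fun _ => MvPolynomial.expand_X _ _

theorem eval₂_wittX {ι : Type*} (x : ι → RamWitt D φ) (i : ι) (n : ℕ) :
    MvPolynomial.eval₂ φ (fun j : ι × ℕ => (x j.1).coeff j.2) (wittX D i n) = ghost n (x i) := by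
  have := map_wittPoly (MvPolynomial.eval₂Hom φ fun j : ι × ℕ => (x j.1).coeff j.2) D.q
    (MvPolynomial.C D.ϖ) n fun m => MvPolynomial.X (i, m)
  rw [MvPolynomial.eval₂Hom_C] at this
  refine this.trans ?_
  simp [ghost]

noncomputable instance : Zero (RamWitt D φ) := ⟨⟨fun _ => 0⟩⟩

noncomputable instance : One (RamWitt D φ) := ⟨⟨fun n => if n = 0 then 1 else 0⟩⟩

noncomputable instance : Add (RamWitt D φ) :=
  ⟨fun x y => eval (wittX D 0 + wittX D 1) fun j : Fin 2 × ℕ => (![x, y] j.1).coeff j.2⟩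

noncomputable instance : Mul (RamWitt D φ) :=
  ⟨fun x y => eval (wittX D 0 * wittX D 1) fun j : Fin 2 × ℕ => (![x, y] j.1).coeff j.2⟩

noncomputable instance : Neg (RamWitt D φ) :=
  ⟨fun x => eval (-wittX D 0) fun j : Fin 1 × ℕ => (![x] j.1).coeff j.2⟩

/-- The vector with all ghost components equal to `r`. -/
noncomputable def scalar (φ : R →+* B) (r : R) : RamWitt D φ :=
  eval (fun _ => MvPolynomial.C r) (PEmpty.elim : PEmpty.{1} → B)

theorem ghost_zero [Fact p.Prime] (n : ℕ) : ghost n (0 : RamWitt D φ) = 0 := by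
  have hq : D.q ≠ 0 := pow_ne_zero _ (Fact.out : p.Prime).ne_zero
  change wittPoly D.q _ n (fun _ => 0) = 0
  simp [wittPoly, hq]

theorem ghost_one [Fact p.Prime] (n : ℕ) : ghost n (1 : RamWitt D φ) = 1 := by
  have hq : D.q ≠ 0 := pow_ne_zero _ (Fact.out : p.Prime).ne_zero
  change wittPoly D.q _ n (fun n => if n = 0 then 1 else 0) = 1
  simp [wittPoly, ite_pow, hq]

theorem ghost_add [Fact p.Prime] (x y : RamWitt D φ) (n : ℕ) :
    ghost n (x + y) = ghost n x + ghost n y := by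
  refine (ghost_eval ((good_wittX D 0).add (good_wittX D 1)) _ n).trans ?_
  rw [Pi.add_apply, MvPolynomial.eval₂_add, eval₂_wittX, eval₂_wittX]
  rfl

theorem ghost_mul [Fact p.Prime] (x y : RamWitt D φ) (n : ℕ) :
    ghost n (x * y) = ghost n x * ghost n y := by
  refine (ghost_eval ((good_wittX D 0).mul (good_wittX D 1)) _ n).trans ?_
  rw [Pi.mul_apply, MvPolynomial.eval₂_mul, eval₂_wittX, eval₂_wittX]
  rfl

theorem ghost_neg [Fact p.Prime] (x : RamWitt D φ) (n : ℕ) : ghost n (-x) = -ghost n x := by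
  refine (ghost_eval (good_wittX D 0).neg _ n).trans ?_
  have := map_neg (MvPolynomial.eval₂Hom φ fun j : Fin 1 × ℕ => (![x] j.1).coeff j.2)
    (wittX D 0 n)
  refine this.trans ?_
  exact congrArg Neg.neg (eval₂_wittX ![x] 0 n)

theorem ghost_scalar [Fact p.Prime] (r : R) (n : ℕ) : ghost n (scalar φ r : RamWitt D φ) = φ r := by
  refine (ghost_eval (D.good_C r) _ n).trans ?_
  rw [MvPolynomial.eval₂_C]

theorem mapFun_zero (ψ : B →+* B') (h : ψ.comp φ = φ') :
    mapFun ψ h (0 : RamWitt D φ) = 0 := by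
  ext n
  exact map_zero ψ

theorem mapFun_one (ψ : B →+* B') (h : ψ.comp φ = φ') :
    mapFun ψ h (1 : RamWitt D φ) = 1 := by
  ext n
  change ψ (if n = 0 then 1 else 0) = if n = 0 then 1 else 0
  split_ifs <;> simp

theorem mapFun_add (ψ : B →+* B') (h : ψ.comp φ = φ') (x y : RamWitt D φ) :
    mapFun ψ h (x + y) = mapFun ψ h x + mapFun ψ h y := by
  refine (mapFun_eval _ _ _ h).trans ?_
  refine congrArg (eval _) (funext fun ⟨i, m⟩ => ?_)
  fin_cases i <;> rfl

theorem mapFun_mul (ψ : B →+* B') (h : ψ.comp φ = φ') (x y : RamWitt D φ) :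
    mapFun ψ h (x * y) = mapFun ψ h x * mapFun ψ h y := by
  refine (mapFun_eval _ _ _ h).trans ?_
  refine congrArg (eval _) (funext fun ⟨i, m⟩ => ?_)
  fin_cases i <;> rfl

theorem mapFun_neg (ψ : B →+* B') (h : ψ.comp φ = φ') (x : RamWitt D φ) :
    mapFun ψ h (-x) = -mapFun ψ h x := by
  refine (mapFun_eval _ _ _ h).trans ?_
  refine congrArg (eval _) (funext fun ⟨i, m⟩ => ?_)
  fin_cases i
  rfl

theorem mapFun_scalar (ψ : B →+* B') (h : ψ.comp φ = φ') (r : R) :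
    mapFun ψ h (scalar φ r : RamWitt D φ) = scalar φ' r := by
  refine (mapFun_eval _ _ _ h).trans ?_
  exact congrArg (eval _) (funext fun i => i.elim)

theorem ext_ghost (hφ : ∀ b, φ D.ϖ * b = 0 → b = 0) {x y : RamWitt D φ}
    (h : ∀ n, ghost n x = ghost n y) : x = y :=
  RamWitt.ext (wittPoly_injective hφ h)

/-- Every ramified Witt vector lifts along `ψ` if `ψ` is surjective. -/
theorem mapFun_surjective (ψ : B →+* B') (h : ψ.comp φ = φ') (hψ : Function.Surjective ψ) :
    Function.Surjective (mapFun ψ h : RamWitt D φ → RamWitt D φ') := fun x => by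
  choose y hy using fun n => hψ (x.coeff n)
  exact ⟨⟨y⟩, RamWitt.ext (funext hy)⟩

/-- `R[X_b : b ∈ B] → B`. -/
noncomputable def cover (φ : R →+* B) : MvPolynomial B R →+* B := MvPolynomial.eval₂Hom φ id

theorem cover_comp (φ : R →+* B) : (cover φ).comp MvPolynomial.C = φ :=
  MvPolynomial.eval₂Hom_comp_C _ _

theorem cover_surjective (φ : R →+* B) : Function.Surjective (cover φ) := fun b =>
  ⟨MvPolynomial.X b, MvPolynomial.eval₂Hom_X' _ _ _⟩

theorem exists_lift (x : RamWitt D φ) :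
    ∃ x' : RamWitt D (MvPolynomial.C : R →+* MvPolynomial B R),
      mapFun (cover φ) (cover_comp φ) x' = x :=
  mapFun_surjective _ _ (cover_surjective φ) x

noncomputable instance [Fact p.Prime] : CommRing (RamWitt D φ) :=
  CommRing.ofMinimalAxioms
    (fun x y z => by
      obtain ⟨x, rfl⟩ := exists_lift x
      obtain ⟨y, rfl⟩ := exists_lift y
      obtain ⟨z, rfl⟩ := exists_lift z
      simp only [← mapFun_add]
      refine congrArg _ (ext_ghost D.C_regular fun n => ?_)
      simp only [ghost_add]
      ring)
    (fun x => by
      obtain ⟨x, rfl⟩ := exists_lift x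
      rw [← mapFun_zero _ (cover_comp φ), ← mapFun_add]
      refine congrArg _ (ext_ghost D.C_regular fun n => ?_)
      simp only [ghost_add, ghost_zero]
      ring)
    (fun x => by
      obtain ⟨x, rfl⟩ := exists_lift x
      rw [← mapFun_zero _ (cover_comp φ), ← mapFun_neg, ← mapFun_add]
      refine congrArg _ (ext_ghost D.C_regular fun n => ?_)
      simp only [ghost_add, ghost_zero, ghost_neg]
      ring)
    (fun x y z => by
      obtain ⟨x, rfl⟩ := exists_lift x
      obtain ⟨y, rfl⟩ := exists_lift y
      obtain ⟨z, rfl⟩ := exists_lift z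
      simp only [← mapFun_mul]
      refine congrArg _ (ext_ghost D.C_regular fun n => ?_)
      simp only [ghost_mul]
      ring)
    (fun x y => by
      obtain ⟨x, rfl⟩ := exists_lift x
      obtain ⟨y, rfl⟩ := exists_lift y
      simp only [← mapFun_mul]
      refine congrArg _ (ext_ghost D.C_regular fun n => ?_)
      simp only [ghost_mul]
      ring)
    (fun x => by
      obtain ⟨x, rfl⟩ := exists_lift x
      rw [← mapFun_one _ (cover_comp φ), ← mapFun_mul]
      refine congrArg _ (ext_ghost D.C_regular fun n => ?_)
      simp only [ghost_mul, ghost_one]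
      ring)
    (fun x y z => by
      obtain ⟨x, rfl⟩ := exists_lift x
      obtain ⟨y, rfl⟩ := exists_lift y
      obtain ⟨z, rfl⟩ := exists_lift z
      simp only [← mapFun_add, ← mapFun_mul]
      refine congrArg _ (ext_ghost D.C_regular fun n => ?_)
      simp only [ghost_add, ghost_mul]
      ring)

/-- The ring structure is the one for which the ghost components are homomorphisms. -/
def ghostHom [Fact p.Prime] (φ : R →+* B) (n : ℕ) : RamWitt D φ →+* B where
  toFun := ghost n
  map_zero' := ghost_zero n
  map_one' := ghost_one n
  map_add' x y := ghost_add x y n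
  map_mul' x y := ghost_mul x y n

/-- Functoriality of ramified Witt vectors. -/
def map [Fact p.Prime] (ψ : B →+* B') (h : ψ.comp φ = φ') : RamWitt D φ →+* RamWitt D φ' where
  toFun := mapFun ψ h
  map_zero' := mapFun_zero ψ h
  map_one' := mapFun_one ψ h
  map_add' := mapFun_add ψ h
  map_mul' := mapFun_mul ψ h

/-- The `R`-algebra structure of the ring of ramified Witt vectors; the scalar `r` has all its ghost
components equal to `r`. -/
noncomputable def scalarHom [Fact p.Prime] (D : WittDatum R p) (φ : R →+* B) :
    R →+* RamWitt D φ :=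
  (map φ (φ.comp_id)).comp
    { toFun := scalar (RingHom.id R)
      map_zero' := ext_ghost D.regular fun n => by simp only [ghost_scalar, ghost_zero, map_zero]
      map_one' := ext_ghost D.regular fun n => by simp only [ghost_scalar, ghost_one, map_one]
      map_add' := fun x y => ext_ghost D.regular fun n => by
        simp only [ghost_scalar, ghost_add, map_add]
      map_mul' := fun x y => ext_ghost D.regular fun n => by
        simp only [ghost_scalar, ghost_mul, map_mul] }

theorem scalarHom_apply [Fact p.Prime] (r : R) : scalarHom D φ r = scalar φ r :=
  mapFun_scalar φ φ.comp_id r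

theorem map_scalarHom [Fact p.Prime] (ψ : B →+* B') (h : ψ.comp φ = φ') (r : R) :
    map ψ h (scalarHom D φ r) = scalarHom D φ' r := by
  rw [scalarHom_apply, scalarHom_apply]
  exact mapFun_scalar ψ h r

end RamWitt

/-! ## The Drinfeld map -/

theorem wittPoly_add {B : Type*} [CommRing B] (q : ℕ) (a : B) (n r : ℕ) (x : ℕ → B) :
    a ^ (n + 1) ∣ wittPoly q a n (fun i => x i ^ q ^ r) - wittPoly q a (n + r) x := by
  induction r generalizing x with
  | zero => simp
  | succ r ih =>
    rw [← add_assoc, wittPoly_succ]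
    have h := ih fun i => x i ^ q
    have h' : (fun i => (x i ^ q) ^ q ^ r) = fun i => x i ^ q ^ (r + 1) := by
      funext i
      rw [← pow_mul, pow_succ', mul_comm]
    rw [h'] at h
    rw [← sub_sub]
    exact dvd_sub h (Dvd.dvd.mul_right (pow_dvd_pow _ (by omega)) _)

/-- A homomorphism `R → R'` with `q' = q ^ r` and `ϖ'` dividing the image of `ϖ`. -/
structure WittDatum.Hom {R R' : Type*} [CommRing R] [CommRing R'] {p : ℕ} (D : WittDatum R p)
    (D' : WittDatum R' p) where
  α : R →+* R'
  r : ℕ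
  hf : D'.f = D.f * r
  hϖ : D'.ϖ ∣ α D.ϖ

namespace RamWitt

section Drinfeld

variable {R' : Type*} [CommRing R'] {D} {D' : WittDatum R' p} (T : D.Hom D')
  {B B' : Type*} [CommRing B] [CommRing B'] {φ : R →+* B} {φ' : R' →+* B}
  {χ : R →+* B'} {χ' : R' →+* B'}

/-- The polynomials `Φ_{rn}`, over `R'`. -/
noncomputable def drinfeldPoly (n : ℕ) : MvPolynomial ℕ R' :=
  wittPoly D.q (MvPolynomial.C (T.α D.ϖ)) (T.r * n) MvPolynomial.X

theorem q_eq : D'.q = D.q ^ T.r := by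
  rw [WittDatum.q, WittDatum.q, T.hf, pow_mul]

theorem good_drinfeldPoly [Fact p.Prime] : D'.Good (drinfeldPoly T) := by
  intro n
  have h : MvPolynomial.expand D'.q (drinfeldPoly T n)
      = wittPoly D.q (MvPolynomial.C (T.α D.ϖ)) (T.r * n)
        fun i => (MvPolynomial.X i : MvPolynomial ℕ R') ^ D.q ^ T.r := by
    have := map_wittPoly (MvPolynomial.expand D'.q : MvPolynomial ℕ R' →ₐ[R'] _).toRingHom D.q
      (MvPolynomial.C (T.α D.ϖ)) (T.r * n) MvPolynomial.X
    refine this.trans ?_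
    congr 1
    · exact MvPolynomial.expand_C _ _
    · funext i
      rw [← q_eq]
      exact MvPolynomial.expand_X _ _
  have hr : 0 < T.r := Nat.pos_of_ne_zero fun h0 => D'.f_pos.ne' (by rw [T.hf, h0, mul_zero])
  rw [h, drinfeldPoly, Nat.mul_succ]
  refine ((pow_dvd_pow_of_dvd (map_dvd MvPolynomial.C T.hϖ) _).trans (pow_dvd_pow _ ?_)).trans
    (wittPoly_add _ _ _ _ _)
  exact Nat.succ_le_succ (Nat.le_mul_of_pos_left n hr)

/-- The Drinfeld map on sets. -/
noncomputable def drinfeldFun (_hφ : φ'.comp T.α = φ) (x : RamWitt D φ) : RamWitt D' φ' :=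
  eval (drinfeldPoly T) x.coeff

theorem ghost_drinfeldFun [Fact p.Prime] (hφ : φ'.comp T.α = φ) (x : RamWitt D φ) (n : ℕ) :
    ghost n (drinfeldFun T hφ x) = ghost (T.r * n) x := by
  refine (ghost_eval (good_drinfeldPoly T) _ n).trans ?_
  have := map_wittPoly (MvPolynomial.eval₂Hom φ' x.coeff) D.q
    (MvPolynomial.C (T.α D.ϖ)) (T.r * n) MvPolynomial.X
  refine this.trans ?_
  subst hφ
  simp [ghost]

theorem mapFun_drinfeldFun (hφ : φ'.comp T.α = φ) (hχ : χ'.comp T.α = χ) (ψ : B →+* B')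
    (h : ψ.comp φ = χ) (h' : ψ.comp φ' = χ') (x : RamWitt D φ) :
    mapFun ψ h' (drinfeldFun T hφ x) = drinfeldFun T hχ (mapFun ψ h x) :=
  mapFun_eval _ _ _ _

/-- The Drinfeld map `u`, characterized functorially by `Φ'_n(u(b)) = Φ_{rn}(b)`. -/
noncomputable def drinfeld [Fact p.Prime] (hφ : φ'.comp T.α = φ) :
    RamWitt D φ →+* RamWitt D' φ' :=
  have hc : (cover φ').comp (MvPolynomial.C.comp T.α) = φ := by
    rw [← RingHom.comp_assoc, cover_comp, hφ]
  have hs : Function.Surjective (mapFun (cover φ') hc : RamWitt D _ → RamWitt D φ) :=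
    mapFun_surjective _ hc (cover_surjective φ')
  { toFun := drinfeldFun T hφ
    map_zero' := by
      rw [← mapFun_zero (cover φ') hc, ← mapFun_zero (cover φ') (cover_comp φ'),
        ← mapFun_drinfeldFun T rfl hφ (cover φ') hc (cover_comp φ')]
      refine congrArg _ (ext_ghost D'.C_regular fun n => ?_)
      simp only [ghost_drinfeldFun, ghost_zero]
    map_one' := by
      rw [← mapFun_one (cover φ') hc, ← mapFun_one (cover φ') (cover_comp φ'),
        ← mapFun_drinfeldFun T rfl hφ (cover φ') hc (cover_comp φ')]
      refine congrArg _ (ext_ghost D'.C_regular fun n => ?_)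
      simp only [ghost_drinfeldFun, ghost_one]
    map_add' := fun x y => by
      obtain ⟨x, rfl⟩ := hs x
      obtain ⟨y, rfl⟩ := hs y
      rw [← mapFun_add]
      simp only [← mapFun_drinfeldFun T rfl hφ (cover φ') hc (cover_comp φ')]
      rw [← mapFun_add]
      refine congrArg _ (ext_ghost D'.C_regular fun n => ?_)
      simp only [ghost_drinfeldFun, ghost_add]
    map_mul' := fun x y => by
      obtain ⟨x, rfl⟩ := hs x
      obtain ⟨y, rfl⟩ := hs y
      rw [← mapFun_mul]
      simp only [← mapFun_drinfeldFun T rfl hφ (cover φ') hc (cover_comp φ')]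
      rw [← mapFun_mul]
      refine congrArg _ (ext_ghost D'.C_regular fun n => ?_)
      simp only [ghost_drinfeldFun, ghost_mul] }

/-- The Drinfeld map is `R`-linear. -/
theorem drinfeld_scalarHom [Fact p.Prime] (hφ : φ'.comp T.α = φ) (r : R) :
    drinfeld T hφ (scalarHom D φ r) = scalarHom D' φ' (T.α r) := by
  have h : drinfeldFun T (φ := T.α) (φ' := RingHom.id R') rfl (scalar T.α r)
      = (scalar (RingHom.id R') (T.α r) : RamWitt D' _) :=
    ext_ghost D'.regular fun n => by
      simp only [ghost_drinfeldFun, ghost_scalar, RingHom.id_apply]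
  rw [scalarHom_apply, scalarHom_apply, ← mapFun_scalar φ' hφ r,
    ← mapFun_scalar φ' (φ'.comp_id) (T.α r), ← h]
  exact (mapFun_drinfeldFun T rfl hφ φ' hφ (φ'.comp_id) _).symm

end Drinfeld

end RamWitt

/-! ## `p`-typical Witt vectors as ramified Witt vectors -/

section Typical

variable (p) in
/-- The datum over `ℤ` with `ϖ = q = p`. -/
def intDatum [Fact p.Prime] : WittDatum ℤ p where
  ϖ := p
  f := 1
  f_pos := one_pos
  regular x hx := by
    have : (p : ℤ) ≠ 0 := by exact_mod_cast (Fact.out : p.Prime).ne_zero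
    exact (mul_eq_zero.1 hx).resolve_left this
  dvd_p := by simp
  frob x := by
    rw [← ZMod.intCast_zmod_eq_zero_iff_dvd]
    simp

variable [Fact p.Prime] {B B' : Type*} [CommRing B] [CommRing B'] {D}

/-- A `p`-typical Witt vector, viewed as a ramified Witt vector over `ℤ`, on sets. -/
def ofWittFun (φ : ℤ →+* B) (x : WittVector p B) : RamWitt (intDatum p) φ := ⟨x.coeff⟩

theorem ghost_ofWittFun (φ : ℤ →+* B) (x : WittVector p B) (n : ℕ) :
    RamWitt.ghost n (ofWittFun φ x) = WittVector.ghostComponent n x := by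
  rw [WittVector.ghostComponent_apply, aeval_wittPolynomial]
  simp [RamWitt.ghost, wittPoly, ofWittFun, intDatum, WittDatum.q]

theorem mapFun_ofWittFun (φ : ℤ →+* B) (φ' : ℤ →+* B') (ψ : B →+* B') (h : ψ.comp φ = φ')
    (x : WittVector p B) :
    RamWitt.mapFun ψ h (ofWittFun φ x) = ofWittFun φ' (WittVector.map ψ x) := by
  ext n
  exact (WittVector.map_coeff ψ x n).symm

/-- `p`-typical Witt vectors are the ramified Witt vectors over `ℤ` with `ϖ = q = p`. -/
def ofWitt (φ : ℤ →+* B) : WittVector p B →+* RamWitt (intDatum p) φ :=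
  have hs : Function.Surjective (WittVector.map (p := p) (RamWitt.cover φ)) :=
    WittVector.map_surjective _ (RamWitt.cover_surjective φ)
  have hc := RamWitt.cover_comp φ
  { toFun := ofWittFun φ
    map_zero' := by
      rw [← map_zero (WittVector.map (RamWitt.cover φ)), ← RamWitt.mapFun_zero (RamWitt.cover φ) hc,
        ← mapFun_ofWittFun MvPolynomial.C φ _ hc]
      refine congrArg _ (RamWitt.ext_ghost (intDatum p).C_regular fun n => ?_)
      simp only [ghost_ofWittFun, RamWitt.ghost_zero, map_zero]
    map_one' := by
      rw [← map_one (WittVector.map (RamWitt.cover φ)), ← RamWitt.mapFun_one (RamWitt.cover φ) hc,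
        ← mapFun_ofWittFun MvPolynomial.C φ _ hc]
      refine congrArg _ (RamWitt.ext_ghost (intDatum p).C_regular fun n => ?_)
      simp only [ghost_ofWittFun, RamWitt.ghost_one, map_one]
    map_add' := fun x y => by
      obtain ⟨x, rfl⟩ := hs x
      obtain ⟨y, rfl⟩ := hs y
      rw [← map_add]
      simp only [← mapFun_ofWittFun MvPolynomial.C φ _ hc]
      rw [← RamWitt.mapFun_add]
      refine congrArg _ (RamWitt.ext_ghost (intDatum p).C_regular fun n => ?_)
      simp only [ghost_ofWittFun, RamWitt.ghost_add, map_add]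
    map_mul' := fun x y => by
      obtain ⟨x, rfl⟩ := hs x
      obtain ⟨y, rfl⟩ := hs y
      rw [← map_mul]
      simp only [← mapFun_ofWittFun MvPolynomial.C φ _ hc]
      rw [← RamWitt.mapFun_mul]
      refine congrArg _ (RamWitt.ext_ghost (intDatum p).C_regular fun n => ?_)
      simp only [ghost_ofWittFun, RamWitt.ghost_mul, map_mul] }

/-- The morphism of data underlying the Drinfeld map from `p`-typical Witt vectors. -/
def typicalHom (D : WittDatum R p) : (intDatum p).Hom D where
  α := Int.castRingHom R
  r := D.f
  hf := (one_mul _).symm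
  hϖ := by simpa [intDatum] using D.dvd_p

/-- The Drinfeld map `u : W(B) → W_R(B)` for an `R`-algebra `B`. -/
noncomputable def typicalDrinfeld (D : WittDatum R p) (φ : R →+* B) :
    WittVector p B →+* RamWitt D φ :=
  (RamWitt.drinfeld (typicalHom D) rfl).comp (ofWitt (φ.comp (Int.castRingHom R)))

theorem ghost_typicalDrinfeld (φ : R →+* B) (x : WittVector p B) (n : ℕ) :
    RamWitt.ghost n (typicalDrinfeld D φ x) = WittVector.ghostComponent (D.f * n) x :=
  (RamWitt.ghost_drinfeldFun (typicalHom D) rfl _ n).trans (ghost_ofWittFun _ _ _)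

theorem map_typicalDrinfeld {φ : R →+* B} {φ' : R →+* B'} (ψ : B →+* B') (h : ψ.comp φ = φ')
    (x : WittVector p B) :
    RamWitt.map ψ h (typicalDrinfeld D φ x) = typicalDrinfeld D φ' (WittVector.map ψ x) := by
  subst h
  refine (RamWitt.mapFun_drinfeldFun _ rfl rfl ψ rfl rfl _).trans ?_
  exact congrArg _ (mapFun_ofWittFun _ _ _ _ _)

end Typical

/-! ## The canonical map `W(k) → R` -/

section Canonical

theorem one_lt_q [Fact p.Prime] : 1 < D.q := Nat.one_lt_pow D.f_pos.ne' (Fact.out : p.Prime).one_lt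

variable {D}

theorem pow_regular (n : ℕ) (x : R) (h : D.ϖ ^ (n + 1) ∣ D.ϖ ^ n * x) : D.ϖ ∣ x := by
  obtain ⟨c, hc⟩ := h
  refine ⟨c, ?_⟩
  rw [pow_succ, mul_assoc] at hc
  have h0 : D.ϖ ^ n * (x - D.ϖ * c) = 0 := by rw [mul_sub, hc, sub_self]
  have : ∀ n y, D.ϖ ^ n * y = 0 → y = 0 := by
    intro n
    induction n with
    | zero => simp
    | succ n ih =>
      intro y hy
      rw [pow_succ, mul_assoc] at hy
      exact D.regular _ (ih _ hy)
  exact sub_eq_zero.1 (this n _ h0)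

theorem dvd_coeff_sub {x y : ℕ → R}
    (h : ∀ n, D.ϖ ^ (n + 1) ∣ wittPoly D.q D.ϖ n x - wittPoly D.q D.ϖ n y) (n : ℕ) :
    D.ϖ ∣ x n - y n := by
  induction n using Nat.strong_induction_on with
  | _ n ih =>
    refine pow_regular n _ ?_
    have hn := h n
    rw [wittPoly, wittPoly, Finset.sum_range_succ, Finset.sum_range_succ, add_sub_add_comm,
      ← Finset.sum_sub_distrib, Nat.sub_self, pow_zero, pow_one, pow_one, ← mul_sub] at hn
    refine (dvd_add_right (Finset.dvd_sum fun i hi => ?_)).1 hn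
    have hi' := Finset.mem_range.1 hi
    rw [← mul_sub, show n + 1 = i + (n - i + 1) by omega, pow_add]
    exact mul_dvd_mul_left _ (dvd_pow_sub_pow D.dvd_q (ih i hi') _)

variable [Fact p.Prime] {k : Type*} [CommRing k] {ρ : R →+* k}

/-- If `R` is `ϖ`-adically complete with residue ring `k`, then `R → W_R(k)` is bijective. -/
theorem scalarHom_bijective [IsAdicComplete (Ideal.span {D.ϖ}) R]
    (hs : Function.Surjective ρ) (hρ : ∀ x, ρ x = 0 ↔ D.ϖ ∣ x) :
    Function.Bijective (RamWitt.scalarHom D ρ) := by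
  have hmod : ∀ n (x y : R), x ≡ y [SMOD (Ideal.span {D.ϖ} ^ n • ⊤ : Ideal R)] ↔
      D.ϖ ^ n ∣ x - y := fun n x y => by
    rw [SModEq.sub_mem, smul_eq_mul, Ideal.mul_top, Ideal.span_singleton_pow,
      Ideal.mem_span_singleton]
  have hcoeff : ∀ r n, (RamWitt.scalarHom D ρ r).coeff n
      = ρ ((RamWitt.scalar (RingHom.id R) r : RamWitt D _).coeff n) := fun r n => rfl
  have hgh : ∀ r n, wittPoly D.q D.ϖ n (RamWitt.scalar (RingHom.id R) r : RamWitt D _).coeff = r :=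
    fun r n => RamWitt.ghost_scalar (φ := RingHom.id R) r n
  constructor
  · refine (injective_iff_map_eq_zero _).2 fun r hr => ?_
    refine IsHausdorff.haus (I := Ideal.span {D.ϖ}) inferInstance r fun n => ?_
    rw [hmod, sub_zero]
    refine (pow_dvd_pow _ n.le_succ).trans ?_
    rw [← hgh r n]
    refine Finset.dvd_sum fun i hi => ?_
    have hi' := Finset.mem_range.1 hi
    have h1 : D.ϖ ∣ (RamWitt.scalar (RingHom.id R) r : RamWitt D _).coeff i := by
      rw [← hρ, ← hcoeff, hr]
      rfl
    rw [Nat.succ_eq_add_one, show n + 1 = i + (n - i + 1) by omega, pow_add]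
    refine mul_dvd_mul_left _ ((pow_dvd_pow _ ?_).trans (pow_dvd_pow_of_dvd h1 _))
    exact Nat.lt_pow_self (one_lt_q D)
  · intro a
    choose b hb using fun n => hs (a.coeff n)
    have hstep : ∀ n, D.ϖ ^ (n + 1) ∣ wittPoly D.q D.ϖ n b - wittPoly D.q D.ϖ (n + 1) b := by
      intro n
      rw [wittPoly_succ, ← sub_sub]
      refine dvd_sub ?_ (dvd_mul_right _ _)
      rw [wittPoly, wittPoly, ← Finset.sum_sub_distrib]
      refine Finset.dvd_sum fun i hi => ?_
      have hi' := Finset.mem_range.1 hi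
      rw [← mul_sub, show n + 1 = i + (n - i + 1) by omega, pow_add]
      refine mul_dvd_mul_left _ ?_
      refine dvd_pow_sub_pow D.dvd_q ?_ _
      rw [← neg_sub]
      exact (D.frob _).neg_right
    obtain ⟨L, hL⟩ := IsPrecomplete.prec (I := Ideal.span {D.ϖ}) inferInstance
      (f := fun n => wittPoly D.q D.ϖ n b) (fun {m n} hmn => by
        rw [hmod]
        induction n, hmn using Nat.le_induction with
        | base => simp
        | succ n hmn ih =>
          have := dvd_add ih ((pow_dvd_pow _ (by omega)).trans (hstep n))
          simpa using this)
    refine ⟨L, RamWitt.ext (funext fun n => ?_)⟩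
    rw [hcoeff, ← hb, ← sub_eq_zero, ← map_sub, hρ]
    refine dvd_coeff_sub (fun m => ?_) n
    rw [hgh, ← neg_sub]
    refine Dvd.dvd.neg_right ?_
    have := dvd_add (hstep m) ((hmod _ _ _).1 (hL (m + 1)))
    simpa using this

/-- The canonical map `W(k) → R` for `R` complete with residue ring `k`: the Drinfeld map
`W(k) → W_R(k)` followed by the inverse of the isomorphism `R ≃ W_R(k)`. -/
noncomputable def canonicalMap [IsAdicComplete (Ideal.span {D.ϖ}) R]
    (hs : Function.Surjective ρ) (hρ : ∀ x, ρ x = 0 ↔ D.ϖ ∣ x) : WittVector p k →+* R :=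
  ((RingEquiv.ofBijective _ (scalarHom_bijective (D := D) hs hρ)).symm : _ →+* R).comp
    (typicalDrinfeld D ρ)

theorem scalarHom_canonicalMap [IsAdicComplete (Ideal.span {D.ϖ}) R]
    (hs : Function.Surjective ρ) (hρ : ∀ x, ρ x = 0 ↔ D.ϖ ∣ x) (x : WittVector p k) :
    RamWitt.scalarHom D ρ (canonicalMap hs hρ x) = typicalDrinfeld D ρ x :=
  (RingEquiv.ofBijective _ (scalarHom_bijective (D := D) hs hρ)).apply_symm_apply _

/-- `canonicalMap` induces the identity on `k`. -/
theorem residue_canonicalMap [IsAdicComplete (Ideal.span {D.ϖ}) R]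
    (hs : Function.Surjective ρ) (hρ : ∀ x, ρ x = 0 ↔ D.ϖ ∣ x) (x : WittVector p k) :
    ρ (canonicalMap hs hρ x) = x.coeff 0 := by
  have h := congrArg (RamWitt.ghost 0) (scalarHom_canonicalMap hs hρ x)
  rw [RamWitt.scalarHom_apply, RamWitt.ghost_scalar, ghost_typicalDrinfeld, mul_zero,
    WittVector.ghostComponent_apply, aeval_wittPolynomial] at h
  simpa using h

end Canonical

/-! ## The data attached to `O` and to `W(k)` -/

section Data

open IsLocalRing

/-- The datum of a discrete valuation ring with uniformizing parameter `π` and residue field of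
cardinality `p ^ h`. -/
def dvrDatum {O : Type*} [CommRing O] [IsDomain O] [IsDiscreteValuationRing O] {p h : ℕ}
    [Fact p.Prime] {π : O} (hπ : Irreducible π) (hk : Nat.card (ResidueField O) = p ^ h) :
    WittDatum O p :=
  have hp : p.Prime := Fact.out
  have hdvd : ∀ x : O, residue O x = 0 → π ∣ x := fun x hx => by
    rwa [residue_eq_zero_iff, hπ.maximalIdeal_eq, Ideal.mem_span_singleton] at hx
  have hfin : Finite (ResidueField O) :=
    Nat.finite_of_card_ne_zero (by rw [hk]; exact pow_ne_zero _ hp.ne_zero)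
  { ϖ := π
    f := h
    f_pos := Nat.pos_of_ne_zero fun h0 => by
      have := Finite.one_lt_card (α := ResidueField O)
      rw [hk, h0, pow_zero] at this
      exact lt_irrefl _ this
    regular := fun x hx => (mul_eq_zero.1 hx).resolve_left hπ.ne_zero
    dvd_p := hdvd _ <| by
      have : Fintype (ResidueField O) := Fintype.ofFinite _
      have h1 := Nat.cast_card_eq_zero (ResidueField O)
      rw [← Nat.card_eq_fintype_card, hk, Nat.cast_pow] at h1
      rw [map_natCast]
      exact eq_zero_of_pow_eq_zero h1
    frob := fun x => hdvd _ <| by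
      have : Fintype (ResidueField O) := Fintype.ofFinite _
      rw [map_sub, map_pow, ← hk, Nat.card_eq_fintype_card, FiniteField.pow_card, sub_self] }

theorem dvrDatum_residue {O : Type*} [CommRing O] [IsDomain O] [IsDiscreteValuationRing O]
    {p h : ℕ} [Fact p.Prime] {π : O} (hπ : Irreducible π)
    (hk : Nat.card (ResidueField O) = p ^ h) (x : O) :
    residue O x = 0 ↔ (dvrDatum hπ hk).ϖ ∣ x := by
  rw [residue_eq_zero_iff, hπ.maximalIdeal_eq, Ideal.mem_span_singleton]
  rfl

theorem charP_of_card {k : Type*} [Field k] {p h : ℕ} [Fact p.Prime] (hk : Nat.card k = p ^ h) :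
    CharP k p := by
  have hp : p.Prime := Fact.out
  have hfin : Finite k := Nat.finite_of_card_ne_zero (by rw [hk]; exact pow_ne_zero _ hp.ne_zero)
  have : Fintype k := Fintype.ofFinite _
  have h1 := Nat.cast_card_eq_zero k
  rw [← Nat.card_eq_fintype_card, hk, Nat.cast_pow] at h1
  exact (CharP.charP_iff_prime_eq_zero hp).2 (eq_zero_of_pow_eq_zero h1)

/-- The datum of `O₀ = W(k)` with uniformizing parameter `p`, for a field `k` with `p ^ h`
elements. -/
noncomputable def wittDatum {k : Type*} [Field k] {p h : ℕ} [Fact p.Prime] (hk : Nat.card k = p ^ h) :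
    WittDatum (WittVector p k) p :=
  have hp : p.Prime := Fact.out
  have hfin : Finite k := Nat.finite_of_card_ne_zero (by rw [hk]; exact pow_ne_zero _ hp.ne_zero)
  have : CharP k p := charP_of_card hk
  { ϖ := p
    f := h
    f_pos := Nat.pos_of_ne_zero fun h0 => by
      have := Finite.one_lt_card (α := k)
      rw [hk, h0, pow_zero] at this
      exact lt_irrefl _ this
    regular := fun x hx => WittVector.eq_zero_of_p_mul_eq_zero x (by rwa [mul_comm])
    dvd_p := dvd_rfl
    frob := fun x => by
      have : Fintype k := Fintype.ofFinite _
      rw [← Ideal.mem_span_singleton, ← WittVector.ker_constantCoeff, RingHom.mem_ker, map_sub,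
        map_pow, ← hk, Nat.card_eq_fintype_card, FiniteField.pow_card, sub_self] }

end Data

/-! ## Tensor products over explicit ring homomorphisms -/

section TensorRing

variable {S B C B' E : Type*} [CommRing S] [CommRing B] [CommRing C] [CommRing B'] [CommRing E]

/-- The ring `B ⊗_S C` for ring homomorphisms `f : S → B` and `g : S → C`. -/
def TensorRing (f : S →+* B) (g : S →+* C) : Type _ :=
  letI := f.toAlgebra
  letI := g.toAlgebra
  TensorProduct S B C

namespace TensorRing

noncomputable instance (f : S →+* B) (g : S →+* C) : CommRing (TensorRing f g) :=
  @Algebra.TensorProduct.instCommRing S B C _ _ f.toAlgebra _ g.toAlgebra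

/-- The element `b ⊗ c`. -/
def tmul (f : S →+* B) (g : S →+* C) (b : B) (c : C) : TensorRing f g :=
  letI := f.toAlgebra
  letI := g.toAlgebra
  TensorProduct.tmul S b c

/-- `b ↦ b ⊗ 1`. -/
noncomputable def inl (f : S →+* B) (g : S →+* C) : B →+* TensorRing f g :=
  letI := f.toAlgebra
  letI := g.toAlgebra
  (Algebra.TensorProduct.includeLeft : B →ₐ[S] TensorProduct S B C).toRingHom

/-- `c ↦ 1 ⊗ c`. -/
noncomputable def inr (f : S →+* B) (g : S →+* C) : C →+* TensorRing f g :=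
  letI := f.toAlgebra
  letI := g.toAlgebra
  (Algebra.TensorProduct.includeRight : C →ₐ[S] TensorProduct S B C).toRingHom

variable {f : S →+* B} {g : S →+* C}

theorem inl_comp (s : S) : inl f g (f s) = inr f g (g s) := by
  let := f.toAlgebra
  let := g.toAlgebra
  exact (Algebra.TensorProduct.includeLeft : B →ₐ[S] TensorProduct S B C).commutes s |>.trans
    ((Algebra.TensorProduct.includeRight : C →ₐ[S] TensorProduct S B C).commutes s).symm

/-- The homomorphism `b ⊗ c ↦ u b * v c`. -/
noncomputable def lift (u : B →+* E) (v : C →+* E) (h : ∀ s, u (f s) = v (g s)) :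
    TensorRing f g →+* E :=
  letI := f.toAlgebra
  letI := g.toAlgebra
  letI := (u.comp f).toAlgebra
  (Algebra.TensorProduct.productMap (R := S) (A := B) (B := C) (S := E)
    { u with commutes' := fun _ => rfl }
    { v with commutes' := fun s => (h s).symm }).toRingHom

theorem lift_tmul (u : B →+* E) (v : C →+* E) (h : ∀ s, u (f s) = v (g s)) (b : B) (c : C) :
    lift u v h (tmul f g b c) = u b * v c :=
  letI := f.toAlgebra
  letI := g.toAlgebra
  letI := (u.comp f).toAlgebra
  Algebra.TensorProduct.productMap_apply_tmul (R := S) (A := B) (B := C) (S := E)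
    { u with commutes' := fun _ => rfl }
    { v with commutes' := fun s => (h s).symm } b c

theorem inl_apply (b : B) : inl f g b = tmul f g b 1 := rfl

theorem inr_apply (c : C) : inr f g c = tmul f g 1 c := rfl

theorem hom_ext {u v : TensorRing f g →+* E} (h : ∀ b c, u (tmul f g b c) = v (tmul f g b c)) :
    u = v := by
  let := f.toAlgebra
  let := g.toAlgebra
  ext x
  refine TensorProduct.induction_on (motive := fun x : TensorProduct S B C => u x = v x) x
    ((map_zero u).trans (map_zero v).symm) h fun x y hx hy => ?_
  exact ((map_add u x y).trans (congrArg₂ _ hx hy)).trans (map_add v x y).symm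

/-- Functoriality in the first factor: `b ⊗ c ↦ w b ⊗ c`. -/
noncomputable def map {f' : S →+* B'} (w : B →+* B') (h : ∀ s, w (f s) = f' s) :
    TensorRing f g →+* TensorRing f' g :=
  lift ((inl f' g).comp w) (inr f' g) fun s => by
    rw [RingHom.comp_apply, h, inl_comp]

theorem map_tmul {f' : S →+* B'} (w : B →+* B') (h : ∀ s, w (f s) = f' s) (b : B) (c : C) :
    map w h (tmul f g b c) = tmul f' g (w b) c := by
  refine (lift_tmul _ _ _ _ _).trans ?_
  let := f'.toAlgebra
  let := g.toAlgebra
  refine (Algebra.TensorProduct.tmul_mul_tmul (R := S) (w b) (1 : B') (1 : C) c).trans ?_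
  rw [mul_one, one_mul]
  rfl

end TensorRing

end TensorRing

/-! ## Ring functors and group functors on `k`-algebras -/

section Functors

variable (k : Type u) [Field k]

/-- The functor of points, on affine `k`-schemes, of a `k`-scheme: `A ↦ Hom_k(Spec A, X)`. -/
noncomputable def points (X : Over (AlgebraicGeometry.Spec (CommRingCat.of k))) :
    CommAlgCat.{u} k ⥤ Type u :=
  (AlgebraicGeometry.algSpec (CommRingCat.of k)).rightOp ⋙ yoneda.obj X

/-- `Spec C` as a `k`-scheme. -/
noncomputable def specOver (C : Type u) [CommRing C] [Algebra k C] :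
    Over (AlgebraicGeometry.Spec (CommRingCat.of k)) :=
  (AlgebraicGeometry.algSpec (CommRingCat.of k)).obj (Opposite.op (CommAlgCat.of k C))

variable {k}

/-- The commutative group functor `G` is, as a functor of sets, the functor of points of the affine
`k`-scheme `Spec C`; that is, the underlying `k`-scheme of `G` is isomorphic to `Spec C`. -/
def IsSpec (G : CommAlgCat.{u} k ⥤ AddCommGrpCat.{u}) (C : Type u) [CommRing C] [Algebra k C] :
    Prop :=
  Nonempty (G ⋙ forget AddCommGrpCat.{u} ≅ points k (specOver k C))

/-- Commutative affine `k`-group schemes, as functors. -/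
def IsAffineGroup (G : CommAlgCat.{u} k ⥤ AddCommGrpCat.{u}) : Prop :=
  ∃ C : CommAlgCat.{u} k, IsSpec G C

/-- Infinitesimal `k`-group schemes: finite and local. -/
def IsInfinitesimal (G : CommAlgCat.{u} k ⥤ AddCommGrpCat.{u}) : Prop :=
  ∃ C : CommAlgCat.{u} k, Module.Finite k C ∧ IsLocalRing C ∧ IsSpec G C

/-- Pro-infinitesimal `k`-group schemes: cofiltered limits of infinitesimal ones. -/
def IsProInfinitesimal (G : CommAlgCat.{u} k ⥤ AddCommGrpCat.{u}) : Prop :=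
  ∃ (J : Type u) (_ : SmallCategory J) (_ : IsCofiltered J)
    (F : J ⥤ CommAlgCat.{u} k ⥤ AddCommGrpCat.{u}) (c : Limits.Cone F),
    (∀ j, IsInfinitesimal (F.obj j)) ∧ Nonempty (Limits.IsLimit c) ∧ Nonempty (c.pt ≅ G)

/-- `0 → N → G → Q → 0` is an exact sequence of commutative affine `k`-group schemes (for the
fpqc topology): `G` is an extension of `Q` by `N`. -/
structure IsExtension {N G Q : CommAlgCat.{u} k ⥤ AddCommGrpCat.{u}} (i : N ⟶ G) (j : G ⟶ Q) :
    Prop where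
  affine_left : IsAffineGroup N
  affine_middle : IsAffineGroup G
  affine_right : IsAffineGroup Q
  injective : ∀ A, Function.Injective (i.app A)
  exact : ∀ A (g : G.obj A), j.app A g = 0 ↔ ∃ n, i.app A n = g
  surjective : ∀ A (x : Q.obj A), ∃ (A' : CommAlgCat.{u} k) (f : A ⟶ A'),
    (f.hom : A →+* A').FaithfullyFlat ∧ ∃ g : G.obj A', j.app A' g = Q.map f x

/-- The kernel of a morphism of ring schemes, as an additive group scheme. -/
noncomputable def ker {F G : CommAlgCat.{u} k ⥤ CommRingCat.{u}} (τ : F ⟶ G) :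
    CommAlgCat.{u} k ⥤ AddCommGrpCat.{u} where
  obj A := AddCommGrpCat.of (RingHom.ker (τ.app A).hom)
  map {A A'} f := AddCommGrpCat.ofHom
    { toFun := fun x => ⟨F.map f x.1, by
        have h := ConcreteCategory.congr_hom (τ.naturality f) x.1
        have hx : τ.app A x.1 = 0 := x.2
        refine h.trans ?_
        change G.map f (τ.app A x.1) = 0
        rw [hx, map_zero]⟩
      map_zero' := Subtype.ext (map_zero (F.map f).hom)
      map_add' := fun x y => Subtype.ext (map_add (F.map f).hom x.1 y.1) }
  map_id A := by
    refine AddCommGrpCat.hom_ext (AddMonoidHom.ext fun x => Subtype.ext ?_)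
    exact ConcreteCategory.congr_hom (F.map_id A) x.1
  map_comp f g := by
    refine AddCommGrpCat.hom_ext (AddMonoidHom.ext fun x => Subtype.ext ?_)
    exact ConcreteCategory.congr_hom (F.map_comp f g) x.1

/-- The product of `e` copies of a commutative group scheme. -/
noncomputable def power (e : ℕ) (G : CommAlgCat.{u} k ⥤ AddCommGrpCat.{u}) :
    CommAlgCat.{u} k ⥤ AddCommGrpCat.{u} where
  obj A := AddCommGrpCat.of (Fin e → G.obj A)
  map f := AddCommGrpCat.ofHom
    { toFun := fun x i => G.map f (x i)
      map_zero' := funext fun _ => map_zero (G.map f).hom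
      map_add' := fun x y => funext fun i => map_add (G.map f).hom (x i) (y i) }
  map_id A := by
    refine AddCommGrpCat.hom_ext (AddMonoidHom.ext fun x => funext fun i => ?_)
    exact ConcreteCategory.congr_hom (G.map_id A) (x i)
  map_comp f g := by
    refine AddCommGrpCat.hom_ext (AddMonoidHom.ext fun x => funext fun i => ?_)
    exact ConcreteCategory.congr_hom (G.map_comp f g) (x i)

/-- The `k`-ring scheme `A ↦ W(A)` of `p`-typical Witt vectors. -/
noncomputable def wittFunctor (p : ℕ) [Fact p.Prime] (k : Type u) [Field k] :
    CommAlgCat.{u} k ⥤ CommRingCat.{u} where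
  obj A := CommRingCat.of (WittVector p A)
  map f := CommRingCat.ofHom (WittVector.map (f.hom : _ →+* _))
  map_id A := by
    ext
    rfl
  map_comp f g := by
    ext
    rfl

theorem comp_scalars {R : Type*} [CommRing R] (ρ : R →+* k) {A A' : CommAlgCat.{u} k}
    (f : A ⟶ A') : (f.hom : A →+* A').comp ((algebraMap k A).comp ρ) = (algebraMap k A').comp ρ := by
  rw [← RingHom.comp_assoc, AlgHom.comp_algebraMap]

/-- The `k`-ring scheme `A ↦ W_R(A)` of ramified Witt vectors, where the `k`-algebra `A` is an
`R`-algebra through `ρ : R → k`. -/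
noncomputable def ramWittFunctor {R : Type u} [CommRing R] {p : ℕ} [Fact p.Prime] (D : WittDatum R p)
    (ρ : R →+* k) : CommAlgCat.{u} k ⥤ CommRingCat.{u} where
  obj A := CommRingCat.of (RamWitt D ((algebraMap k A).comp ρ))
  map f := CommRingCat.ofHom (RamWitt.map (f.hom : _ →+* _) (comp_scalars ρ f))
  map_id A := by
    ext x
    rfl
  map_comp f g := by
    ext x
    rfl

/-- A structure of `S`-algebra scheme on a ring functor: its values are `S`-algebras,
functorially. -/
structure Scalars (S : Type u) [CommRing S] (F : CommAlgCat.{u} k ⥤ CommRingCat.{u}) where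
  hom (A : CommAlgCat.{u} k) : S →+* F.obj A
  naturality {A A' : CommAlgCat.{u} k} (f : A ⟶ A') (x : S) :
    (F.map f).hom (hom A x) = hom A' x

variable {S O : Type u} [CommRing S] [CommRing O] {F G : CommAlgCat.{u} k ⥤ CommRingCat.{u}}

/-- For `F` with values in `S`-algebras and `ι : S → O`, the ring functor `A ↦ F(A) ⊗_S O`. -/
noncomputable def tensorFunctor (s : Scalars S F) (ι : S →+* O) :
    CommAlgCat.{u} k ⥤ CommRingCat.{u} where
  obj A := CommRingCat.of (TensorRing (s.hom A) ι)
  map f := CommRingCat.ofHom (TensorRing.map (F.map f).hom (s.naturality f))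
  map_id A := by
    refine CommRingCat.hom_ext (TensorRing.hom_ext fun b c => ?_)
    refine (TensorRing.map_tmul _ (s.naturality (𝟙 A)) _ _).trans ?_
    rw [F.map_id]
    rfl
  map_comp {A A' A''} f g := by
    refine CommRingCat.hom_ext (TensorRing.hom_ext fun b c => ?_)
    refine (TensorRing.map_tmul _ (s.naturality (f ≫ g)) _ _).trans ?_
    change _ = TensorRing.map _ (s.naturality g) (TensorRing.map _ (s.naturality f) _)
    rw [TensorRing.map_tmul, TensorRing.map_tmul, F.map_comp]
    rfl

/-- The morphism `F(A) ⊗_S O → G(A)` extending `τ : F → G` by `O`-linearity, where `G` has values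
in `O`-algebras. -/
noncomputable def tensorLift (s : Scalars S F) (ι : S →+* O) (t : Scalars O G)
    (τ : F ⟶ G) (hτ : ∀ A x, (τ.app A).hom (s.hom A x) = t.hom A (ι x)) :
    tensorFunctor s ι ⟶ G where
  app A := CommRingCat.ofHom (TensorRing.lift (τ.app A).hom (t.hom A) (hτ A))
  naturality A A' f := by
    refine CommRingCat.hom_ext (TensorRing.hom_ext fun b c => ?_)
    change TensorRing.lift _ _ (hτ A') (TensorRing.map _ (s.naturality f) _)
      = (G.map f).hom (TensorRing.lift _ _ (hτ A) _)
    rw [TensorRing.map_tmul, TensorRing.lift_tmul, TensorRing.lift_tmul, map_mul, t.naturality]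
    congr 1
    exact ConcreteCategory.congr_hom (τ.naturality f) b

/-- `W_R` is an `R`-algebra scheme. -/
noncomputable def ramWittScalars {p : ℕ} [Fact p.Prime] {R : Type u} [CommRing R]
    (D : WittDatum R p) (ρ : R →+* k) : Scalars R (ramWittFunctor D ρ) where
  hom A := RamWitt.scalarHom D ((algebraMap k A).comp ρ)
  naturality f x := RamWitt.map_scalarHom _ (comp_scalars ρ f) x

/-- `W` on `k`-algebras has values in `W(k)`-algebras. -/
noncomputable def wittScalars (p : ℕ) [Fact p.Prime] (k : Type u) [Field k] :
    Scalars (WittVector p k) (wittFunctor p k) where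
  hom A := WittVector.map (algebraMap k A)
  naturality f x := WittVector.ext fun n => f.hom.commutes (x.coeff n)

end Functors

/-! ## Greenberg algebra and the comparison morphism -/

section Main

open IsLocalRing

variable {O : Type u} [CommRing O] [IsDomain O] [IsDiscreteValuationRing O] {p h : ℕ}
  [Fact p.Prime] {π : O} (hπ : Irreducible π) (hk : Nat.card (ResidueField O) = p ^ h)

/-- The special fibre of the ring scheme of ramified Witt vectors over `O`. -/
noncomputable abbrev ramWittO : CommAlgCat.{u} (ResidueField O) ⥤ CommRingCat.{u} :=
  ramWittFunctor (dvrDatum hπ hk) (residue O)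

/-- The special fibre of the ring scheme of ramified Witt vectors over `O₀ = W(k)`. -/
noncomputable abbrev ramWittO₀ : CommAlgCat.{u} (ResidueField O) ⥤ CommRingCat.{u} :=
  ramWittFunctor (wittDatum hk) WittVector.constantCoeff

/-- The special fibre of the Drinfeld morphism from `ℤ_p` to `O`. -/
noncomputable def drinfeldO : wittFunctor p (ResidueField O) ⟶ ramWittO hπ hk where
  app A := CommRingCat.ofHom
    (typicalDrinfeld (dvrDatum hπ hk) ((algebraMap (ResidueField O) A).comp (residue O)))
  naturality A A' f := by
    ext x
    exact (map_typicalDrinfeld _ (comp_scalars _ f) x).symm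

/-- The special fibre of the Drinfeld morphism from `ℤ_p` to `O₀ = W(k)`. -/
noncomputable def drinfeldO₀ : wittFunctor p (ResidueField O) ⟶ ramWittO₀ hk where
  app A := CommRingCat.ofHom
    (typicalDrinfeld (wittDatum hk)
      ((algebraMap (ResidueField O) A).comp WittVector.constantCoeff))
  naturality A A' f := by
    ext x
    exact (map_typicalDrinfeld _ (comp_scalars _ f) x).symm

variable [IsAdicComplete (maximalIdeal O) O]

theorem isAdicComplete_dvrDatum : IsAdicComplete (Ideal.span {(dvrDatum hπ hk).ϖ}) O := by
  have : IsAdicComplete (maximalIdeal O) O := inferInstance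
  rwa [hπ.maximalIdeal_eq] at this

/-- The canonical embedding `O₀ = W(k) → O`. -/
noncomputable def embO₀ : WittVector p (ResidueField O) →+* O :=
  have := isAdicComplete_dvrDatum hπ hk
  canonicalMap (D := dvrDatum hπ hk) residue_surjective (dvrDatum_residue hπ hk)

theorem residue_embO₀ (x : WittVector p (ResidueField O)) :
    residue O (embO₀ hπ hk x) = x.coeff 0 :=
  have := isAdicComplete_dvrDatum hπ hk
  residue_canonicalMap (D := dvrDatum hπ hk) residue_surjective (dvrDatum_residue hπ hk) x

/-- The data for the Drinfeld morphism from `O₀` to `O`. -/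
noncomputable def homO₀ : (wittDatum hk).Hom (dvrDatum hπ hk) where
  α := embO₀ hπ hk
  r := 1
  hf := (mul_one _).symm
  hϖ := by
    have : embO₀ hπ hk (wittDatum hk).ϖ = (p : O) := map_natCast _ p
    rw [this]
    exact (dvrDatum hπ hk).dvd_p

theorem comp_homO₀ (A : CommAlgCat.{u} (ResidueField O)) :
    ((algebraMap (ResidueField O) A).comp (residue O)).comp (homO₀ hπ hk).α
      = (algebraMap (ResidueField O) A).comp WittVector.constantCoeff :=
  RingHom.ext fun x => congrArg (algebraMap (ResidueField O) A) (residue_embO₀ hπ hk x)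

/-- The special fibre of the Drinfeld morphism from `O₀ = W(k)` to `O`. -/
noncomputable def drinfeldRam : ramWittO₀ hk ⟶ ramWittO hπ hk where
  app A := CommRingCat.ofHom (RamWitt.drinfeld (homO₀ hπ hk) (comp_homO₀ hπ hk A))
  naturality A A' f := by
    ext x
    exact (RamWitt.mapFun_drinfeldFun (homO₀ hπ hk) (comp_homO₀ hπ hk A) (comp_homO₀ hπ hk A')
      _ (comp_scalars _ f) (comp_scalars _ f) x).symm

/-- The Greenberg algebra of `O`: the `k`-ring scheme `A ↦ W(A) ⊗_{W(k)} O`. -/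
noncomputable def greenberg : CommAlgCat.{u} (ResidueField O) ⥤ CommRingCat.{u} :=
  tensorFunctor (wittScalars p (ResidueField O)) (embO₀ hπ hk)

/-- The morphism `r`: the `O`-linear extension `W(A) ⊗_{W(k)} O → W_O(A)` of the Drinfeld map. -/
noncomputable def r : greenberg hπ hk ⟶ ramWittO hπ hk :=
  tensorLift _ _ (ramWittScalars (dvrDatum hπ hk) (residue O)) (drinfeldO hπ hk) fun A x => by
    have := isAdicComplete_dvrDatum hπ hk
    have h1 := scalarHom_canonicalMap (D := dvrDatum hπ hk) residue_surjective
      (dvrDatum_residue hπ hk) x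
    have h2 := congrArg (RamWitt.map (φ' := (algebraMap (ResidueField O) A).comp (residue O))
      (algebraMap (ResidueField O) A) rfl) h1
    rw [RamWitt.map_scalarHom, map_typicalDrinfeld] at h2
    exact h2.symm

/-- The morphism `W(A) → W(A) ⊗_{W(k)} O`, `x ↦ x ⊗ 1`. -/
noncomputable def toGreenberg : wittFunctor p (ResidueField O) ⟶ greenberg hπ hk where
  app A := CommRingCat.ofHom (TensorRing.inl ((wittScalars p (ResidueField O)).hom A) (embO₀ hπ hk))
  naturality A A' f := by
    ext x
    exact (TensorRing.map_tmul _ ((wittScalars p (ResidueField O)).naturality f) _ _).symm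

/-- The `k`-ring scheme `A ↦ W_{O₀}(A) ⊗_{O₀} O`. -/
noncomputable def ramTensor : CommAlgCat.{u} (ResidueField O) ⥤ CommRingCat.{u} :=
  tensorFunctor (ramWittScalars (wittDatum hk) WittVector.constantCoeff) (embO₀ hπ hk)

/-- The morphism `u^ra` on special fibres, for the totally ramified extension `O` of `O₀`: the
`O`-linear extension `W_{O₀}(A) ⊗_{O₀} O → W_O(A)` of the Drinfeld map. -/
noncomputable def uRam : ramTensor hπ hk ⟶ ramWittO hπ hk :=
  tensorLift _ _ (ramWittScalars (dvrDatum hπ hk) (residue O)) (drinfeldRam hπ hk) fun A x =>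
    RamWitt.drinfeld_scalarHom (homO₀ hπ hk) (comp_homO₀ hπ hk A) x

/-- `k[X_0, X_1, …] / (X_0, …, X_i^{p^{i(h-1)}}, …)`. -/
abbrev UnramRing (k : Type u) [Field k] (p h : ℕ) : Type u :=
  MvPolynomial ℕ k ⧸ Ideal.span (Set.range fun i : ℕ =>
    (MvPolynomial.X i : MvPolynomial ℕ k) ^ p ^ (i * (h - 1)))

/-- `k[X_{n,i}; n ≥ 0, 0 ≤ i < e] / (X_{n,i}^{q^{n(e-1)+i}})`. -/
abbrev RamRing (k : Type u) [Field k] (q e : ℕ) : Type u :=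
  MvPolynomial (ℕ × Fin e) k ⧸ Ideal.span (Set.range fun j : ℕ × Fin e =>
    (MvPolynomial.X j : MvPolynomial (ℕ × Fin e) k) ^ q ^ (j.1 * (e - 1) + (j.2 : ℕ)))

end Main

end RamifiedWitt

/-!
Over a polynomial ring mapping onto the given algebra, ghost components that agree modulo
`ϖ ^ (n + 1)` for all `n` come from Witt components that agree modulo `ϖ`. Write `p = ε π ^ e` with
a unit `ε`. The `n`-th ghost component of `∑ i < e, u(x_i) π ^ i` is
`∑ ε ^ m π ^ (e m + i) x_{i,m} ^ (p ^ (h n - m))`. Its terms with `j = e m + i ≤ n` are those of the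
Witt vector `∑ ε ^ m V ^ j [x_{i,m} ^ (p ^ (h j - m))]`, and the others are divisible by
`π ^ (n + 1)`. As distinct pairs `(i, m)` occupy distinct components `j`, the sum vanishes on
`k`-algebras exactly when `x_{i,m} ^ (p ^ (m (h e - 1) + h i)) = 0` for all `i` and `m`. Since
`1, π, …, π ^ (e - 1)` is a basis of `O` over `W(k)`, this computes `ker r`, and the same argument
with `q = p ^ h` in place of `p` computes `ker u^ra`.

In general `r` is the composite of `u ⊗ O` and `u^ra`. In terms of components `u ⊗ O` raises to
powers of `p`, so its kernel is the `e`-th power of `ker u`, and every point of its target lifts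
after a faithfully flat extension adjoining roots. The kernels are the limits of their truncations
to finitely many components.
-/

namespace RamifiedWitt

/-! ## Witt vectors modulo `ϖ` -/

theorem dvd_sub_of_dvd_wittPoly_sub {B : Type*} [CommRing B] {q : ℕ} {a : B}
    (ha : ∀ x, a * x = 0 → x = 0) (haq : a ∣ (q : B)) {x y : ℕ → B} {N : ℕ}
    (h : ∀ n < N, a ^ (n + 1) ∣ wittPoly q a n x - wittPoly q a n y) :
    ∀ n < N, a ∣ x n - y n := by
  intro n
  induction n using Nat.strong_induction_on with
  | _ n ih =>
    intro hnN
    have hlow : a ^ (n + 1) ∣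
        ∑ i ∈ Finset.range n, (a ^ i * x i ^ q ^ (n - i) - a ^ i * y i ^ q ^ (n - i)) := by
      refine Finset.dvd_sum fun i hi => ?_
      have hin := Finset.mem_range.1 hi
      rw [← mul_sub, show n + 1 = i + (n - i + 1) by omega, pow_add]
      exact mul_dvd_mul_left _ (dvd_pow_sub_pow haq (ih i hin (hin.trans hnN)) _)
    have htop : a ^ n * a ∣ a ^ n * (x n - y n) := by
      have hn := h n hnN
      rw [wittPoly, wittPoly, Finset.sum_range_succ, Finset.sum_range_succ, add_sub_add_comm,
        ← Finset.sum_sub_distrib, Nat.sub_self, pow_zero, pow_one, pow_one, ← mul_sub] at hn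
      simpa only [pow_succ] using (dvd_add_right hlow).1 hn
    have hreg : IsLeftRegular a := isLeftRegular_iff_right_eq_zero_of_mul.2 ha
    obtain ⟨c, hc⟩ := htop
    exact ⟨c, hreg.pow n (by simpa only [mul_assoc] using hc)⟩

namespace RamWitt

variable {R : Type*} [CommRing R] {p : ℕ} {D : WittDatum R p}
  {B B' : Type*} [CommRing B] [CommRing B'] {φ : R →+* B} {φ' : R →+* B'}

theorem coeff_mapFun_eq_of_dvd_ghost_sub (ψ : B' →+* B) (hψ : ψ.comp φ' = φ)
    (hreg : ∀ x, φ' D.ϖ * x = 0 → x = 0) (hϖ : φ D.ϖ = 0) {x y : RamWitt D φ'} {N : ℕ}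
    (h : ∀ n < N, φ' D.ϖ ^ (n + 1) ∣ ghost n x - ghost n y) :
    ∀ n < N, (mapFun ψ hψ x).coeff n = (mapFun ψ hψ y).coeff n := by
  intro n hn
  have hq : φ' D.ϖ ∣ (D.q : B') := by simpa only [map_natCast] using map_dvd φ' D.dvd_q
  have hdvd := map_dvd ψ (dvd_sub_of_dvd_wittPoly_sub hreg hq h n hn)
  rw [← RingHom.comp_apply, hψ, hϖ, zero_dvd_iff, map_sub] at hdvd
  exact sub_eq_zero.1 hdvd

/-- `V ^ j [b]`: the Witt vector whose only nonzero component is `b`, at the index `j`. -/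
def single (j : ℕ) (b : B) : RamWitt D φ := ⟨Pi.single j b⟩

theorem single_zero (j : ℕ) : (single j 0 : RamWitt D φ) = 0 :=
  RamWitt.ext (Pi.single_zero j)

theorem mapFun_single (ψ : B →+* B') (h : ψ.comp φ = φ') (j : ℕ) (b : B) :
    mapFun ψ h (single j b : RamWitt D φ) = single j (ψ b) :=
  RamWitt.ext (funext fun n => (Pi.apply_single (fun _ => ψ) (fun _ => map_zero ψ) j b n))

variable [Fact p.Prime]

theorem coeff_sub_congr (hϖ : φ D.ϖ = 0) {x x' y y' : RamWitt D φ} {N : ℕ}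
    (hx : ∀ n < N, x.coeff n = x'.coeff n) (hy : ∀ n < N, y.coeff n = y'.coeff n) :
    ∀ n < N, (x - y).coeff n = (x' - y').coeff n := by
  let lift (z : RamWitt D φ) : RamWitt D (MvPolynomial.C : R →+* MvPolynomial B R) :=
    ⟨fun n => MvPolynomial.X (z.coeff n)⟩
  have map_lift (z : RamWitt D φ) : map (cover φ) (cover_comp φ) (lift z) = z :=
    RamWitt.ext (funext fun n => MvPolynomial.eval₂Hom_X' _ _ _)
  have ghost_lift {z z' : RamWitt D φ} (h : ∀ n < N, z.coeff n = z'.coeff n) (n : ℕ) (hn : n < N) :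
      ghostHom _ n (lift z) = ghostHom _ n (lift z') := by
    change ghost n (lift z) = ghost n (lift z')
    rw [ghost, ghost, wittPoly, wittPoly]
    refine Finset.sum_congr rfl fun i hi => ?_
    simp only [lift, h i ((Finset.mem_range_succ_iff.1 hi).trans_lt hn)]
  rw [← map_lift x, ← map_lift x', ← map_lift y, ← map_lift y', ← map_sub, ← map_sub]
  refine coeff_mapFun_eq_of_dvd_ghost_sub (cover φ) (cover_comp φ) D.C_regular hϖ fun n hn => ?_
  change _ ∣ ghostHom _ n (lift x - lift y) - ghostHom _ n (lift x' - lift y')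
  rw [map_sub, map_sub, ghost_lift hx n hn, ghost_lift hy n hn, sub_self]
  exact dvd_zero _

theorem coeff_sub_eq_zero_iff (hϖ : φ D.ϖ = 0) (x y : RamWitt D φ) (N : ℕ) :
    (∀ n < N, (x - y).coeff n = 0) ↔ ∀ n < N, x.coeff n = y.coeff n := by
  constructor <;> intro h n hn
  · have := coeff_sub_congr hϖ (fun n _ => rfl : ∀ n < N, x.coeff n = x.coeff n) (y' := 0) h n hn
    rwa [sub_sub_cancel, sub_zero, eq_comm] at this
  · have := coeff_sub_congr hϖ h (fun n _ => rfl : ∀ n < N, y.coeff n = y.coeff n) n hn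
    rwa [sub_self] at this

theorem ghost_single (j : ℕ) (b : B) (n : ℕ) :
    ghost n (single j b : RamWitt D φ)
      = if j ≤ n then φ D.ϖ ^ j * b ^ D.q ^ (n - j) else 0 := by
  have hq (m : ℕ) : D.q ^ m ≠ 0 := (pow_pos (one_lt_q D).le m).ne'
  have hterm (i : ℕ) : φ D.ϖ ^ i * (Pi.single j b : ℕ → B) i ^ D.q ^ (n - i)
      = if i = j then φ D.ϖ ^ j * b ^ D.q ^ (n - j) else 0 := by
    split_ifs with hij
    · rw [hij, Pi.single_eq_same]
    · rw [Pi.single_eq_of_ne hij, zero_pow (hq _), mul_zero]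
  simp only [ghost, wittPoly, single, hterm, Finset.sum_ite_eq', Finset.mem_range_succ_iff]

theorem map_scalarHom_mul_single (ψ : B →+* B') (h : ψ.comp φ = φ') (r : R) (j : ℕ) (b : B) :
    map ψ h (scalarHom D φ r * single j b) = scalarHom D φ' r * single j (ψ b) := by
  rw [map_mul, map_scalarHom]
  exact congrArg _ (mapFun_single ψ h j b)

theorem ghost_scalarHom_mul_single (r : R) (j : ℕ) (b : B) (n : ℕ) :
    ghost n (scalarHom D φ r * single j b)
      = if j ≤ n then φ r * (φ D.ϖ ^ j * b ^ D.q ^ (n - j)) else 0 := by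
  rw [ghost_mul, scalarHom_apply, ghost_scalar, ghost_single, mul_ite, mul_zero]

theorem coeff_scalarHom_mul_single (hϖ : φ D.ϖ = 0) (r : R) (N : ℕ) (b : B) :
    (scalarHom D φ r * single N b).coeff N = φ r * b := by
  obtain ⟨b, rfl⟩ := cover_surjective φ b
  have hcover : cover φ (MvPolynomial.C r) = φ r := by
    rw [← RingHom.comp_apply, cover_comp]
  rw [← map_scalarHom_mul_single _ (cover_comp φ), ← hcover, ← map_mul]
  refine (coeff_mapFun_eq_of_dvd_ghost_sub (cover φ) (cover_comp φ) D.C_regular hϖ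
    (y := single N (MvPolynomial.C r * b)) (fun n hn => ?_) N N.lt_succ_self).trans ?_
  · rw [ghost_scalarHom_mul_single, ghost_single]
    split_ifs with h
    · obtain rfl : N = n := by omega
      rw [Nat.sub_self, pow_zero, pow_one, pow_one, mul_left_comm, sub_self]
      exact dvd_zero _
    · rw [sub_self]
      exact dvd_zero _
  · rw [mapFun_single]
    exact Pi.single_eq_same _ _

section VanishingCriterion

variable (ψ : B' →+* B) (hψ : ψ.comp φ' = φ) (hreg : ∀ x, φ' D.ϖ * x = 0 → x = 0)
  (hϖ : φ D.ϖ = 0) {w : RamWitt D φ'} {y : ℕ → B'} {ε : ℕ → R}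
  (hw : ∀ n, φ' D.ϖ ^ (n + 1) ∣ ghost n w
    - ∑ j ∈ Finset.range (n + 1), φ' (ε j) * (φ' D.ϖ ^ j * y j ^ D.q ^ (n - j)))

include hreg hϖ hw

theorem coeff_mapFun_eq_coeff_sum (N : ℕ) : ∀ n < N, (mapFun ψ hψ w).coeff n
    = (∑ j ∈ Finset.range N, scalarHom D φ (ε j) * single j (ψ (y j))).coeff n := by
  have hmap : ∑ j ∈ Finset.range N, scalarHom D φ (ε j) * single j (ψ (y j))
      = map ψ hψ (∑ j ∈ Finset.range N, scalarHom D φ' (ε j) * single j (y j)) := by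
    simp only [map_sum, map_scalarHom_mul_single]
  rw [hmap]
  refine coeff_mapFun_eq_of_dvd_ghost_sub ψ hψ hreg hϖ fun n hn => ?_
  convert hw n using 2
  change ghostHom φ' n _ = _
  rw [map_sum]
  change ∑ j ∈ Finset.range N, ghost n _ = _
  simp only [ghost_scalarHom_mul_single, ← Finset.sum_filter]
  refine Finset.sum_congr (Finset.ext fun j => ?_) fun _ _ => rfl
  rw [Finset.mem_filter, Finset.mem_range, Finset.mem_range]
  omega

/-- The hypothesis says `w ≡ ∑ ε_j V ^ j [y_j]` modulo `ϖ`. -/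
theorem mapFun_eq_zero_iff (hε : ∀ j, IsUnit (ε j)) :
    mapFun ψ hψ w = 0 ↔ ∀ j, ψ (y j) = 0 := by
  have coeff_eq (N : ℕ) (hN : ∀ j < N, ψ (y j) = 0) :
      (mapFun ψ hψ w).coeff N = φ (ε N) * ψ (y N) := by
    have hlow : ∑ j ∈ Finset.range N, scalarHom D φ (ε j) * single j (ψ (y j)) = 0 :=
      Finset.sum_eq_zero fun j hj => by
        rw [hN j (Finset.mem_range.1 hj), single_zero, mul_zero]
    rw [coeff_mapFun_eq_coeff_sum ψ hψ hreg hϖ hw (N + 1) N N.lt_succ_self,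
      Finset.sum_range_succ, hlow, zero_add, coeff_scalarHom_mul_single hϖ]
  constructor
  · intro hzero j
    induction j using Nat.strong_induction_on with
    | _ N ih =>
      have hN := coeff_eq N ih
      rw [hzero] at hN
      exact ((hε N).map φ).mul_right_eq_zero.1 hN.symm
  · intro hy
    refine RamWitt.ext (funext fun N => ?_)
    rw [coeff_eq N fun j _ => hy j, hy N, mul_zero]
    rfl

end VanishingCriterion

end RamWitt

/-! ## Formulas for Drinfeld maps -/

theorem sum_range_sum_fin {M : Type*} [AddCommMonoid M] (e N : ℕ) (F : ℕ → M) :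
    ∑ m ∈ Finset.range N, ∑ i : Fin e, F (e * m + i) = ∑ j ∈ Finset.range (e * N), F j := by
  induction N with
  | zero => simp
  | succ N ih =>
    rw [Finset.sum_range_succ, ih, Nat.mul_succ, Finset.sum_range_add,
      Fin.sum_univ_eq_sum_range (fun i => F (e * N + i))]

theorem ofNat_mul_add {e : ℕ} [NeZero e] (m : ℕ) (i : Fin e) : Fin.ofNat e (e * m + i) = i :=
  Fin.ext (by rw [Fin.val_ofNat, Nat.mul_add_mod, Nat.mod_eq_of_lt i.2])

theorem mul_add_div {e : ℕ} [NeZero e] (m : ℕ) (i : Fin e) : (e * m + i) / e = m := by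
  rw [Nat.mul_add_div (NeZero.pos e), Nat.div_eq_of_lt i.2, add_zero]

namespace RamWitt

variable {R R' : Type*} [CommRing R] [CommRing R'] {p : ℕ} {D : WittDatum R p}
  {D' : WittDatum R' p} {B : Type*} [CommRing B] {φ : R →+* B} {φ' : R' →+* B}

theorem hom_r_pos (T : D.Hom D') : 0 < T.r :=
  Nat.pos_of_mul_pos_left (T.hf ▸ D'.f_pos)

theorem cover_comp_hom (T : D.Hom D') (hφ : φ'.comp T.α = φ) :
    (cover φ').comp ((MvPolynomial.C : R' →+* MvPolynomial B R').comp T.α) = φ := by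
  rw [← RingHom.comp_assoc, cover_comp, hφ]

variable [Fact p.Prime]

theorem coeff_drinfeld (T : D.Hom D') (hφ : φ'.comp T.α = φ) (hT : T.α D.ϖ = D'.ϖ)
    (hϖ : φ' D'.ϖ = 0) (x : RamWitt D φ) (n : ℕ) :
    (drinfeld T hφ x).coeff n = x.coeff n ^ D.q ^ (n * (T.r - 1)) := by
  have hc := cover_comp_hom T hφ
  obtain ⟨x, rfl⟩ := mapFun_surjective (cover φ') hc (cover_surjective φ') x
  change (drinfeldFun T hφ _).coeff n = cover φ' (x.coeff n) ^ _
  rw [← mapFun_drinfeldFun T rfl hφ (cover φ') hc (cover_comp φ'), ← map_pow]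
  refine coeff_mapFun_eq_of_dvd_ghost_sub (cover φ') (cover_comp φ') D'.C_regular hϖ
    (y := ⟨fun i => x.coeff i ^ D.q ^ (i * (T.r - 1))⟩) (fun m _ => ?_) n n.lt_succ_self
  obtain ⟨s, hs⟩ := Nat.exists_eq_add_one.2 (hom_r_pos T)
  have hhead : ghost m (⟨fun i => x.coeff i ^ D.q ^ (i * (T.r - 1))⟩ : RamWitt D' MvPolynomial.C)
      = ∑ i ∈ Finset.range (m + 1), MvPolynomial.C D'.ϖ ^ i * x.coeff i ^ D.q ^ (T.r * m - i) := by
    rw [ghost, wittPoly]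
    refine Finset.sum_congr rfl fun i hi => ?_
    obtain ⟨l, rfl⟩ := Nat.exists_eq_add_of_le (Finset.mem_range_succ_iff.1 hi)
    have hexp : (s + 1) * (i + l) - i = i * s + (s + 1) * l := by
      rw [Nat.sub_eq_iff_eq_add (by nlinarith)]; ring
    rw [q_eq T, hs, hexp, Nat.add_sub_cancel, Nat.add_sub_cancel_left, ← pow_mul, ← pow_mul,
      ← pow_add]
  have htail : T.r * m + 1 = m + 1 + s * m := by rw [hs]; ring
  rw [ghost_drinfeldFun, hhead, ghost, wittPoly, RingHom.comp_apply, hT, htail,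
    Finset.sum_range_add, add_sub_cancel_left]
  exact Finset.dvd_sum fun i _ => (pow_dvd_pow _ (Nat.le_add_right _ _)).mul_right _

section EisensteinSum

variable (T : D.Hom D') (hφ : φ'.comp T.α = φ) {e : ℕ} {ε : R'} (hT : T.α D.ϖ = ε * D'.ϖ ^ e)

include hT

theorem ghost_drinfeld_mul_scalarHom_pow (x : RamWitt D φ) (i n : ℕ) :
    ghost n (drinfeld T hφ x * scalarHom D' φ' (D'.ϖ ^ i)) = ∑ m ∈ Finset.range (T.r * n + 1),
      φ' (ε ^ m) * (φ' D'.ϖ ^ (e * m + i) * x.coeff m ^ D.q ^ (T.r * n - m)) := by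
  rw [ghost_mul, scalarHom_apply, ghost_scalar]
  change ghost n (drinfeldFun T hφ x) * _ = _
  have hϖ : φ D.ϖ = φ' ε * φ' D'.ϖ ^ e := by
    rw [← hφ, RingHom.comp_apply, hT, map_mul, map_pow]
  rw [ghost_drinfeldFun, ghost, wittPoly, hϖ, Finset.sum_mul]
  refine Finset.sum_congr rfl fun m _ => ?_
  rw [map_pow, map_pow]
  ring

variable [NeZero e]

theorem ghost_sum_drinfeld_mul_scalarHom_pow (x : Fin e → RamWitt D φ) (n : ℕ) :
    ghost n (∑ i, drinfeld T hφ (x i) * scalarHom D' φ' (D'.ϖ ^ (i : ℕ)))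
      = ∑ j ∈ Finset.range (e * (T.r * n + 1)), φ' (ε ^ (j / e)) * (φ' D'.ϖ ^ j *
          (x (Fin.ofNat e j)).coeff (j / e) ^ D.q ^ (T.r * n - j / e)) := by
  rw [← sum_range_sum_fin, Finset.sum_comm]
  change ghostHom φ' n _ = _
  rw [map_sum]
  refine Finset.sum_congr rfl fun i _ => (ghost_drinfeld_mul_scalarHom_pow T hφ hT _ _ _).trans ?_
  simp only [ofNat_mul_add, mul_add_div]

theorem ghost_sum_drinfeld_congr (x : Fin e → RamWitt D φ) (n : ℕ) :
    φ' D'.ϖ ^ (n + 1) ∣ ghost n (∑ i, drinfeld T hφ (x i) * scalarHom D' φ' (D'.ϖ ^ (i : ℕ)))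
      - ∑ j ∈ Finset.range (n + 1), φ' (ε ^ (j / e)) * (φ' D'.ϖ ^ j *
          ((x (Fin.ofNat e j)).coeff (j / e) ^ D.q ^ (T.r * j - j / e)) ^ D'.q ^ (n - j)) := by
  have hr := hom_r_pos T
  have hrange : e * (T.r * n + 1) = n + 1 + (e * (T.r * n + 1) - (n + 1)) := by
    have := Nat.mul_le_mul (Nat.mul_le_mul (NeZero.pos e) hr) (le_refl n)
    have := NeZero.pos e
    rw [Nat.add_sub_cancel' (by nlinarith)]
  have hhead (j : ℕ) (hj : j ∈ Finset.range (n + 1)) :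
      φ' (ε ^ (j / e)) * (φ' D'.ϖ ^ j *
        ((x (Fin.ofNat e j)).coeff (j / e) ^ D.q ^ (T.r * j - j / e)) ^ D'.q ^ (n - j))
      = φ' (ε ^ (j / e)) * (φ' D'.ϖ ^ j *
          (x (Fin.ofNat e j)).coeff (j / e) ^ D.q ^ (T.r * n - j / e)) := by
    obtain ⟨l, rfl⟩ := Nat.exists_eq_add_of_le (Finset.mem_range_succ_iff.1 hj)
    have hdiv : j / e ≤ T.r * j := (Nat.div_le_self j e).trans (Nat.le_mul_of_pos_left j hr)
    have hexp : T.r * j - j / e + T.r * l = T.r * (j + l) - j / e := by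
      rw [mul_add, Nat.sub_add_comm hdiv]
    rw [q_eq T, Nat.add_sub_cancel_left, ← pow_mul D.q, ← pow_mul, ← pow_add, hexp]
  rw [ghost_sum_drinfeld_mul_scalarHom_pow T hφ hT, Finset.sum_congr rfl hhead, hrange,
    Finset.sum_range_add, add_sub_cancel_left]
  exact Finset.dvd_sum fun j _ =>
    ((pow_dvd_pow _ (Nat.le_add_right _ _)).mul_right _).mul_left _

theorem sum_drinfeld_mul_scalarHom_pow_eq_zero_iff (hε : IsUnit ε) (hϖ : φ' D'.ϖ = 0)
    (x : Fin e → RamWitt D φ) :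
    ∑ i, drinfeld T hφ (x i) * scalarHom D' φ' (D'.ϖ ^ (i : ℕ)) = 0 ↔
      ∀ (n : ℕ) (i : Fin e), (x i).coeff n ^ D.q ^ (n * (T.r * e - 1) + T.r * i) = 0 := by
  have hc := cover_comp_hom T hφ
  choose x' hx' using fun i => mapFun_surjective (cover φ') hc (cover_surjective φ') (x i)
  obtain rfl : (fun i => mapFun (cover φ') hc (x' i)) = x := funext hx'
  have hmap : ∑ i, drinfeld T hφ (mapFun (cover φ') hc (x' i)) * scalarHom D' φ' (D'.ϖ ^ (i : ℕ))
      = map (cover φ') (cover_comp φ')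
        (∑ i, drinfeld T rfl (x' i) * scalarHom D' _ (D'.ϖ ^ (i : ℕ))) := by
    rw [map_sum]
    refine Finset.sum_congr rfl fun i _ => ?_
    rw [map_mul, map_scalarHom]
    exact congrArg (· * _) (mapFun_drinfeldFun T rfl hφ _ hc (cover_comp φ') _).symm
  have hexp (n : ℕ) (i : Fin e) : T.r * (e * n + i) - n = n * (T.r * e - 1) + T.r * i := by
    obtain ⟨d, hd⟩ := Nat.exists_eq_add_one.2 (Nat.mul_pos (hom_r_pos T) (NeZero.pos e))
    rw [mul_add, ← mul_assoc, hd, Nat.add_sub_cancel, add_one_mul, add_right_comm,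
      Nat.add_sub_cancel, mul_comm n]
  rw [hmap]
  refine (mapFun_eq_zero_iff (cover φ') (cover_comp φ') D'.C_regular hϖ
    (ghost_sum_drinfeld_congr T rfl hT x') fun j => hε.pow (j / e)).trans ?_
  simp only [map_pow]
  constructor
  · intro H n i
    have := H (e * n + i)
    rwa [ofNat_mul_add, mul_add_div, hexp] at this
  · intro H j
    have := H (j / e) (Fin.ofNat e j)
    rwa [← hexp, Fin.val_ofNat, Nat.div_add_mod] at this

end EisensteinSum

end RamWitt

section Typical

variable {R : Type*} [CommRing R] {p : ℕ} [Fact p.Prime] {D : WittDatum R p}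
  {B : Type*} [CommRing B] {φ : R →+* B}

theorem coeff_typicalDrinfeld (hp : D.ϖ = p) (hϖ : φ D.ϖ = 0) (x : WittVector p B) (n : ℕ) :
    (typicalDrinfeld D φ x).coeff n = x.coeff n ^ p ^ (n * (D.f - 1)) := by
  refine (RamWitt.coeff_drinfeld (typicalHom D) rfl ?_ hϖ _ n).trans ?_
  · rw [hp]
    exact map_natCast _ p
  · rw [WittDatum.q, show (intDatum p).f = 1 from rfl, pow_one]
    rfl

theorem sum_typicalDrinfeld_mul_scalarHom_pow_eq_zero_iff {e : ℕ} [NeZero e] {ε : R}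
    (hp : (p : R) = ε * D.ϖ ^ e) (hε : IsUnit ε) (hϖ : φ D.ϖ = 0) (x : Fin e → WittVector p B) :
    ∑ i, typicalDrinfeld D φ (x i) * RamWitt.scalarHom D φ (D.ϖ ^ (i : ℕ)) = 0 ↔
      ∀ (n : ℕ) (i : Fin e), (x i).coeff n ^ p ^ (n * (D.f * e - 1) + D.f * i) = 0 := by
  have h := RamWitt.sum_drinfeld_mul_scalarHom_pow_eq_zero_iff (typicalHom D) rfl
    ((map_natCast _ p).trans hp) hε hϖ fun i => ofWitt _ (x i)
  rw [WittDatum.q, show (intDatum p).f = 1 from rfl, pow_one] at h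
  exact h

theorem drinfeld_typicalDrinfeld {R' : Type*} [CommRing R'] {D' : WittDatum R' p} (T : D.Hom D')
    {φ' : R' →+* B} (hφ : φ'.comp T.α = φ) (x : WittVector p B) :
    RamWitt.drinfeld T hφ (typicalDrinfeld D φ x) = typicalDrinfeld D' φ' x := by
  have hc := RamWitt.cover_comp_hom T hφ
  obtain ⟨x, rfl⟩ := WittVector.map_surjective (RamWitt.cover φ') (RamWitt.cover_surjective φ') x
  rw [← map_typicalDrinfeld _ hc, ← map_typicalDrinfeld _ (RamWitt.cover_comp φ')]
  refine (RamWitt.mapFun_drinfeldFun T rfl hφ _ hc (RamWitt.cover_comp φ') _).symm.trans ?_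
  refine congrArg _ (RamWitt.ext_ghost D'.C_regular fun n => ?_)
  rw [RamWitt.ghost_drinfeldFun, ghost_typicalDrinfeld, ghost_typicalDrinfeld, T.hf, mul_assoc]

end Typical

section CanonicalMap

variable {p : ℕ} [Fact p.Prime] {k S : Type*} [CommRing S]

theorem finite_of_card_eq_pow {h : ℕ} (hk : Nat.card k = p ^ h) : Finite k :=
  Nat.finite_of_card_ne_zero (by rw [hk]; exact pow_ne_zero _ (Fact.out : p.Prime).ne_zero)

/-- On Teichmüller representatives the two maps agree because
`[a] = [a ^ (1 / p ^ n)] ^ p ^ n` and raising to the `p ^ n`-th power improves congruences. -/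
theorem wittVector_ringHom_ext [CommRing k] [CharP k p] [PerfectRing k p]
    [IsHausdorff (Ideal.span {(p : S)}) S] {f g : WittVector p k →+* S}
    (h : ∀ x, (p : S) ∣ f x - g x) : f = g := by
  ext x
  refine sub_eq_zero.1 (IsHausdorff.haus (I := Ideal.span {(p : S)}) inferInstance _ fun n => ?_)
  rw [SModEq.zero, smul_eq_mul, Ideal.mul_top, Ideal.span_singleton_pow, ← Ideal.Quotient.eq]
  let π := Ideal.Quotient.mk (Ideal.span {(p : S) ^ n})
  refine DFunLike.congr_fun (f := π.comp f) (g := π.comp g)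
    (WittVector.eq_of_apply_teichmuller_eq _ _ ⟨n, ?_⟩ fun a => ?_) x
  · rw [← map_natCast π, ← map_pow]
    exact Ideal.Quotient.mk_singleton_self _
  · obtain ⟨b, rfl⟩ := (bijective_iterateFrobenius k p n).surjective a
    rw [iterateFrobenius_def, map_pow]
    refine Ideal.Quotient.eq.2 (Ideal.mem_span_singleton.2 ?_)
    rw [map_pow, map_pow]
    exact (pow_dvd_pow _ n.le_succ).trans (dvd_sub_pow_of_dvd_sub (h _) n)

theorem constantCoeff_eq_zero_iff [CommRing k] [CharP k p] [PerfectRing k p] (x : WittVector p k) :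
    WittVector.constantCoeff x = 0 ↔ (p : WittVector p k) ∣ x := by
  rw [← RingHom.mem_ker, WittVector.ker_constantCoeff, Ideal.mem_span_singleton]

theorem typicalDrinfeld_wittDatum [Field k] {h : ℕ} (hk : Nat.card k = p ^ h) (x : WittVector p k) :
    typicalDrinfeld (wittDatum hk) WittVector.constantCoeff x
      = RamWitt.scalarHom (wittDatum hk) WittVector.constantCoeff x := by
  have := finite_of_card_eq_pow hk
  have : CharP k p := charP_of_card hk
  have : IsAdicComplete (Ideal.span {(wittDatum hk).ϖ}) (WittVector p k) :=
    WittVector.isAdicCompleteIdealSpanP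
  have hs : Function.Surjective (WittVector.constantCoeff : WittVector p k →+* k) :=
    WittVector.constantCoeff_surjective p
  have hρ (y : WittVector p k) : WittVector.constantCoeff y = 0 ↔ (wittDatum hk).ϖ ∣ y :=
    constantCoeff_eq_zero_iff y
  have hid : canonicalMap hs hρ = RingHom.id _ := wittVector_ringHom_ext fun y => by
    rw [RingHom.id_apply, ← constantCoeff_eq_zero_iff, map_sub, sub_eq_zero]
    exact residue_canonicalMap hs hρ y
  have hx := scalarHom_canonicalMap hs hρ x
  rw [hid] at hx
  exact hx.symm

end CanonicalMap

/-! ## Adic bases and the structure of `O` over `W(k)` -/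

theorem mem_span_pow_smul_top {S M : Type*} [CommRing S] [AddCommGroup M] [Module S M] {a : S}
    {n : ℕ} {x : M} :
    x ∈ (Ideal.span {a} ^ n • ⊤ : Submodule S M) ↔ ∃ y, a ^ n • y = x := by
  rw [Ideal.span_singleton_pow, Submodule.ideal_span_singleton_smul,
    Submodule.mem_smul_pointwise_iff_exists]
  simp only [Submodule.mem_top, true_and]

theorem isPrecomplete_pi {S : Type*} [CommRing S] {a : S} [IsPrecomplete (Ideal.span {a}) S]
    (J : Type*) : IsPrecomplete (Ideal.span {a}) (J → S) := by
  refine ⟨fun f hf => ?_⟩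
  have hcoord (j : J) : ∃ L : S, ∀ n, f n j ≡ L [SMOD (Ideal.span {a} ^ n • ⊤ : Ideal S)] :=
    IsPrecomplete.prec inferInstance fun {m n} hmn => by
      obtain ⟨y, hy⟩ := mem_span_pow_smul_top.1 (SModEq.sub_mem.1 (hf hmn))
      exact SModEq.sub_mem.2 (mem_span_pow_smul_top.2 ⟨y j, congrFun hy j⟩)
  choose L hL using hcoord
  refine ⟨L, fun n => SModEq.sub_mem.2 (mem_span_pow_smul_top.2 ?_)⟩
  choose y hy using fun j => mem_span_pow_smul_top.1 (SModEq.sub_mem.1 (hL j n))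
  exact ⟨y, funext hy⟩

section AdicBasis

variable {S O : Type*} [CommRing S] [CommRing O] {ι : S →+* O} {a : S} {π : O} {e : ℕ}

theorem exists_pow_dvd_sub_sum (hι : ∀ c, ∃ s, π ∣ c - ι s) (c : O) :
    ∃ x : Fin e → S, π ^ e ∣ c - ∑ i, ι (x i) * π ^ (i : ℕ) := by
  induction e with
  | zero => exact ⟨0, by simp only [pow_zero, isUnit_one, IsUnit.dvd]⟩
  | succ m ih =>
    obtain ⟨x, d, hd⟩ := ih
    obtain ⟨s, b, hb⟩ := hι d
    refine ⟨Fin.snoc x s, b, ?_⟩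
    simp only [Fin.sum_univ_castSucc, Fin.snoc_castSucc, Fin.snoc_last, Fin.val_castSucc,
      Fin.val_last]
    linear_combination hd + π ^ m * hb

theorem sum_mul_pow_surjective [IsPrecomplete (Ideal.span {a}) S]
    [IsHausdorff (Ideal.span {ι a}) O] (hι : ∀ c, ∃ s, π ∣ c - ι s) (ha : ι a ∣ π ^ e) :
    Function.Surjective fun x : Fin e → S => ∑ i, ι (x i) * π ^ (i : ℕ) := by
  let := ι.toAlgebra
  have : IsHausdorff (Ideal.span {a}) O :=
    (IsHausdorff.map_algebraMap_iff (S := O)).1 (by rwa [Ideal.map_span, Set.image_singleton])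
  have := isPrecomplete_pi (a := a) (Fin e)
  refine surjective_of_mkQ_comp_surjective (I := Ideal.span {a})
    (f := Fintype.linearCombination S fun i : Fin e => π ^ (i : ℕ)) fun c => ?_
  obtain ⟨c, rfl⟩ := Submodule.mkQ_surjective _ c
  obtain ⟨x, hx⟩ := exists_pow_dvd_sub_sum (e := e) hι c
  obtain ⟨d, hd⟩ := ha.trans hx
  refine ⟨x, ((Submodule.Quotient.eq _).2 ?_).symm⟩
  rw [← pow_one (Ideal.span {a}), mem_span_pow_smul_top]
  exact ⟨d, by rw [pow_one]; exact hd.symm⟩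

theorem dvd_of_pow_dvd_sum_mul_pow (hπ : IsLeftRegular π) (hι : ∀ s, π ∣ ι s → a ∣ s)
    (ha : π ^ e ∣ ι a) {x : Fin e → S} (hx : π ^ e ∣ ∑ i, ι (x i) * π ^ (i : ℕ)) (i : Fin e) :
    a ∣ x i := by
  induction i using WellFoundedLT.induction with
  | _ i ih =>
    have hrest : π ^ ((i : ℕ) + 1) ∣ ∑ j ∈ Finset.univ.erase i, ι (x j) * π ^ (j : ℕ) := by
      refine Finset.dvd_sum fun j hj => ?_
      rcases lt_or_gt_of_ne (Finset.ne_of_mem_erase hj) with hji | hij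
      · exact (((pow_dvd_pow π i.2).trans ha).trans (map_dvd ι (ih j hji))).mul_right _
      · exact (pow_dvd_pow _ (Nat.succ_le_of_lt hij)).mul_left _
    have hsum := (pow_dvd_pow π i.2).trans hx
    rw [← Finset.add_sum_erase _ _ (Finset.mem_univ i)] at hsum
    obtain ⟨c, hc⟩ := (dvd_add_left hrest).1 hsum
    refine hι _ ⟨c, hπ.pow i ?_⟩
    linear_combination hc

theorem sum_mul_pow_injective [IsHausdorff (Ideal.span {a}) S] (hπ : IsLeftRegular π)
    (hι : ∀ s, π ∣ ι s → a ∣ s) (ha : π ^ e ∣ ι a) (hreg : IsLeftRegular (ι a)) :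
    Function.Injective fun x : Fin e → S => ∑ i, ι (x i) * π ^ (i : ℕ) := by
  let Φ : (Fin e → S) →+ O :=
    ∑ i : Fin e, (AddMonoidHom.mulRight (π ^ (i : ℕ))).comp
      ((ι : S →+ O).comp (Pi.evalAddMonoidHom _ i))
  have hΦ (x : Fin e → S) : Φ x = ∑ i, ι (x i) * π ^ (i : ℕ) := by
    rw [AddMonoidHom.finsetSum_apply]; rfl
  suffices h : Function.Injective Φ from fun x y hxy => h (by rw [hΦ, hΦ]; exact hxy)
  have hdvd (n : ℕ) : ∀ x, Φ x = 0 → ∀ i, a ^ n ∣ x i := by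
    induction n with
    | zero => exact fun x _ i => by rw [pow_zero]; exact one_dvd _
    | succ n ih =>
      intro x hx
      choose y hy using dvd_of_pow_dvd_sum_mul_pow hπ hι ha
        (((dvd_zero _).trans hx.symm.dvd).trans (hΦ x).dvd)
      have hxy : Φ x = ι a * Φ y := by
        simp only [hΦ, hy, map_mul, mul_assoc, Finset.mul_sum]
      have hΦy : Φ y = 0 := hreg (by simpa only [mul_zero, hx] using hxy.symm)
      exact fun i => by rw [hy, pow_succ']; exact mul_dvd_mul_left _ (ih y hΦy i)
  refine (injective_iff_map_eq_zero Φ).2 fun x hx => funext fun i => ?_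
  refine IsHausdorff.haus (I := Ideal.span {a}) inferInstance _ fun n => SModEq.zero.2 ?_
  obtain ⟨c, hc⟩ := hdvd n x hx i
  exact mem_span_pow_smul_top.2 ⟨c, hc.symm⟩

end AdicBasis

section Structure

open IsLocalRing

theorem exists_unit_mul_pow {O : Type*} [CommRing O] [IsDomain O] [IsDiscreteValuationRing O]
    {π : O} (hπ : Irreducible π) {x : O} {e : ℕ} (hx : IsDiscreteValuationRing.addVal O x = e) :
    ∃ ε : Oˣ, x = ε * π ^ e := by
  rw [← hπ.addVal_pow, IsDiscreteValuationRing.addVal_eq_iff_associated] at hx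
  obtain ⟨ε, hε⟩ := hx.symm
  exact ⟨ε, by rw [← hε, mul_comm]⟩

theorem ramificationIndex_neZero {O : Type*} [CommRing O] [IsDomain O]
    [IsDiscreteValuationRing O] {p h e : ℕ} [Fact p.Prime] {π : O} (hπ : Irreducible π)
    (hk : Nat.card (ResidueField O) = p ^ h)
    (he : IsDiscreteValuationRing.addVal O (p : O) = e) : NeZero e := by
  refine ⟨?_⟩
  rintro rfl
  have hunit : IsUnit (p : O) := IsDiscreteValuationRing.addVal_eq_zero_iff.1 he
  exact hπ.not_isUnit (isUnit_of_dvd_unit (dvrDatum hπ hk).dvd_p hunit)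

variable {O : Type u} [CommRing O] [IsDomain O] [IsDiscreteValuationRing O] {p h : ℕ}
  [Fact p.Prime] {π : O} (hπ : Irreducible π) (hk : Nat.card (ResidueField O) = p ^ h)

variable [IsAdicComplete (maximalIdeal O) O]

theorem dvd_embO₀_iff (x : WittVector p (ResidueField O)) :
    π ∣ embO₀ hπ hk x ↔ (p : WittVector p (ResidueField O)) ∣ x := by
  have : CharP (ResidueField O) p := charP_of_card hk
  have := finite_of_card_eq_pow hk
  rw [← constantCoeff_eq_zero_iff]
  exact (dvrDatum_residue hπ hk _).symm.trans (by rw [residue_embO₀]; rfl)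

theorem exists_dvd_sub_embO₀ (c : O) : ∃ s, π ∣ c - embO₀ hπ hk s :=
  ⟨WittVector.teichmuller p (residue O c), (dvrDatum_residue hπ hk _).1 (by
    rw [map_sub, residue_embO₀, WittVector.teichmuller_coeff_zero, sub_self])⟩

theorem sum_embO₀_mul_pow_bijective [CharZero O] {e : ℕ}
    (he : IsDiscreteValuationRing.addVal O (p : O) = e) :
    Function.Bijective fun x : Fin e → WittVector p (ResidueField O) =>
      ∑ i, embO₀ hπ hk (x i) * π ^ (i : ℕ) := by
  have : CharP (ResidueField O) p := charP_of_card hk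
  have := finite_of_card_eq_pow hk
  obtain ⟨ε, hε⟩ := exists_unit_mul_pow hπ he
  have hp : embO₀ hπ hk p = ε * π ^ e := by rw [map_natCast, hε]
  have hp0 : embO₀ hπ hk p ≠ 0 := by
    rw [map_natCast]
    exact Nat.cast_ne_zero.2 (Fact.out : p.Prime).ne_zero
  have : IsHausdorff (Ideal.span {embO₀ hπ hk p}) O := .of_isLocalRing _ _ fun htop =>
    hπ.not_isUnit (isUnit_of_dvd_unit ((dvd_embO₀_iff hπ hk p).2 dvd_rfl)
      (Ideal.span_singleton_eq_top.1 htop))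
  exact ⟨sum_mul_pow_injective (IsRegular.of_ne_zero hπ.ne_zero).left
      (fun s => (dvd_embO₀_iff hπ hk s).1) (Dvd.intro_left _ hp.symm)
      (IsRegular.of_ne_zero hp0).left,
    sum_mul_pow_surjective (a := (p : WittVector p (ResidueField O)))
      (exists_dvd_sub_embO₀ hπ hk) ⟨↑ε⁻¹, by rw [hp, mul_right_comm, Units.mul_inv, one_mul]⟩⟩

end Structure

/-! ## Coordinates on ring functors and their base changes -/

namespace TensorRing

variable {S B C B' E : Type*} [CommRing S] [CommRing B] [CommRing C] [CommRing B'] [CommRing E]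
  {f : S →+* B} {f' : S →+* B'} {g : S →+* C}

theorem tmul_eq_mul (b : B) (c : C) : tmul f g b c = inl f g b * inr f g c := by
  let := f.toAlgebra
  let := g.toAlgebra
  refine Eq.trans ?_ (Algebra.TensorProduct.tmul_mul_tmul (R := S) b (1 : B) (1 : C) c).symm
  rw [mul_one, one_mul]
  rfl

theorem inl_bijective (hg : Function.Bijective g) : Function.Bijective (inl f g) :=
  let := f.toAlgebra
  let := g.toAlgebra
  Algebra.TensorProduct.includeLeft_bijective (S := S) hg

theorem map_leftInverse {w : B →+* B'} {v : B' →+* B} (hw : ∀ s, w (f s) = f' s)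
    (hv : ∀ s, v (f' s) = f s) (h : Function.LeftInverse v w) :
    Function.LeftInverse (map (g := g) v hv) (map w hw) :=
  RingHom.congr_fun (f := (map v hv).comp (map w hw)) (g := .id _) (hom_ext fun b c => by
    rw [RingHom.comp_apply, map_tmul, map_tmul, h b, RingHom.id_apply])

theorem map_bijective {w : B →+* B'} (hw : ∀ s, w (f s) = f' s) (hbij : Function.Bijective w) :
    Function.Bijective (map (g := g) w hw) := by
  let v : B ≃+* B' := RingEquiv.ofBijective w hbij
  have hv : ∀ s, (v.symm : B' →+* B) (f' s) = f s := fun s => v.symm_apply_eq.2 (hw s).symm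
  exact Function.bijective_iff_has_inverse.2 ⟨map (v.symm : B' →+* B) hv,
    map_leftInverse hw hv v.symm_apply_apply, map_leftInverse hv hw v.apply_symm_apply⟩

variable {I : Type*} [Fintype I] {b : I → C}

theorem sum_tmul_bijective (hb : Function.Bijective fun a : I → S => ∑ i, g (a i) * b i) :
    Function.Bijective fun x : I → B => ∑ i, tmul f g (x i) (b i) := by
  let := f.toAlgebra
  let := g.toAlgebra
  let v : Module.Basis I S C :=
    .ofEquivFun (LinearEquiv.ofBijective (Fintype.linearCombination S b) hb).symm
  have hv (i : I) : v i = b i := by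
    classical
    rw [Module.Basis.coe_ofEquivFun]
    exact (Fintype.linearCombination_apply_single S b i 1).trans (one_smul S _)
  have : (fun x : I → B => ∑ i, TensorProduct.tmul S (x i) (b i))
      = (Algebra.TensorProduct.basis B v).equivFun.symm := by
    funext x
    rw [Module.Basis.equivFun_symm_apply]
    refine Finset.sum_congr rfl fun i _ => ?_
    rw [Algebra.TensorProduct.basis_apply, hv, TensorProduct.smul_tmul', smul_eq_mul, mul_one]
  exact this ▸ LinearEquiv.bijective _

/-- The coordinates on `B ⊗_S C` with respect to a basis `b` of `C` over `S`. -/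
noncomputable def piEquiv (f : S →+* B)
    (hb : Function.Bijective fun a : I → S => ∑ i, g (a i) * b i) : (I → B) ≃+ TensorRing f g :=
  AddEquiv.ofBijective
    ({ toFun := fun x => ∑ i, tmul f g (x i) (b i)
       map_zero' := by simp [tmul_eq_mul]
       map_add' := fun x y => by simp [tmul_eq_mul, add_mul, Finset.sum_add_distrib] } :
      (I → B) →+ TensorRing f g)
    (sum_tmul_bijective hb)

variable (hb : Function.Bijective fun a : I → S => ∑ i, g (a i) * b i)

theorem map_piEquiv (w : B →+* B') (hw : ∀ s, w (f s) = f' s) (x : I → B) :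
    map w hw (piEquiv f hb x) = piEquiv f' hb fun i => w (x i) :=
  (map_sum (map w hw) _ _).trans (Finset.sum_congr rfl fun _ _ => map_tmul _ _ _ _)

theorem piEquiv_symm_map (w : B →+* B') (hw : ∀ s, w (f s) = f' s) (z : TensorRing f g) (i : I) :
    (piEquiv f' hb).symm (map w hw z) i = w ((piEquiv f hb).symm z i) := by
  obtain ⟨x, rfl⟩ := (piEquiv f hb).surjective z
  rw [map_piEquiv, AddEquiv.symm_apply_apply, AddEquiv.symm_apply_apply]

theorem lift_eq_sum (v : B →+* E) (w : C →+* E) (h : ∀ s, v (f s) = w (g s)) (z : TensorRing f g) :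
    lift v w h z = ∑ i, v ((piEquiv f hb).symm z i) * w (b i) := by
  obtain ⟨x, rfl⟩ := (piEquiv f hb).surjective z
  rw [AddEquiv.symm_apply_apply]
  exact (map_sum (lift v w h) _ _).trans (Finset.sum_congr rfl fun _ _ => lift_tmul _ _ _ _ _)

end TensorRing

section BaseChange

variable {k : Type u} [Field k] {F G : CommAlgCat.{u} k ⥤ CommRingCat.{u}}

theorem isIso_of_bijective_app (τ : F ⟶ G) (hτ : ∀ A, Function.Bijective (τ.app A).hom) :
    IsIso τ := by
  have : ∀ A, IsIso (τ.app A) := fun A =>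
    (RingEquiv.ofBijective (τ.app A).hom (hτ A)).toCommRingCatIso.isIso_hom
  exact NatIso.isIso_of_isIso_app τ

variable {S O : Type u} [CommRing S] [CommRing O] (s : Scalars S F) (t : Scalars S G) (ι : S →+* O)

/-- The morphism `F(A) ⊗_S O → G(A) ⊗_S O` induced by an `S`-linear morphism `F → G`. -/
noncomputable def tensorMap (τ : F ⟶ G) (hτ : ∀ A x, (τ.app A).hom (s.hom A x) = t.hom A x) :
    tensorFunctor s ι ⟶ tensorFunctor t ι where
  app A := CommRingCat.ofHom (TensorRing.map (τ.app A).hom (hτ A))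
  naturality A A' f := by
    refine CommRingCat.hom_ext (TensorRing.hom_ext fun b c => ?_)
    change TensorRing.map _ (hτ A') (TensorRing.map _ (s.naturality f) _)
      = TensorRing.map _ (t.naturality f) (TensorRing.map _ (hτ A) _)
    rw [TensorRing.map_tmul, TensorRing.map_tmul, TensorRing.map_tmul, TensorRing.map_tmul]
    exact congrArg (TensorRing.tmul _ _ · c) (ConcreteCategory.congr_hom (τ.naturality f) b)

theorem tensorMap_comp_tensorLift {H : CommAlgCat.{u} k ⥤ CommRingCat.{u}} (v : Scalars O H)
    (σ : F ⟶ G) (hσ : ∀ A x, (σ.app A).hom (s.hom A x) = t.hom A x)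
    (τ : G ⟶ H) (hτ : ∀ A x, (τ.app A).hom (t.hom A x) = v.hom A (ι x))
    (hστ : ∀ A x, ((σ ≫ τ).app A).hom (s.hom A x) = v.hom A (ι x)) :
    tensorMap s t ι σ hσ ≫ tensorLift t ι v τ hτ = tensorLift s ι v (σ ≫ τ) hστ := by
  ext A : 2
  refine CommRingCat.hom_ext (TensorRing.hom_ext fun b c => ?_)
  refine (congrArg (TensorRing.lift _ _ (hτ A)) (TensorRing.map_tmul _ (hσ A) b c)).trans ?_
  exact (TensorRing.lift_tmul _ _ (hτ A) _ c).trans (TensorRing.lift_tmul _ _ (hστ A) b c).symm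

end BaseChange

/-- A level function `ℓ` on the coordinates `c A : H A → A ^ J` is compatible with the addition if
the points whose coordinates of level `< N` vanish form a subgroup, whose cosets are the fibres of
the projection to the coordinates of level `< N`. -/
def IsLevel {k : Type u} [Field k] {H : CommAlgCat.{u} k → Type*} [∀ A, AddCommGroup (H A)]
    {J : Type} (c : ∀ A : CommAlgCat.{u} k, H A → J → A) (ℓ : J → ℕ) : Prop :=
  ∀ (A : CommAlgCat.{u} k) (N : ℕ) (x y : H A),
    (∀ j, ℓ j < N → c A (x - y) j = 0) ↔ ∀ j, ℓ j < N → c A x j = c A y j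

/-- Coordinates on a ring functor `F`: an identification of `F`, as a functor of sets, with
`A ↦ A ^ J`. -/
structure Coordinates {k : Type u} [Field k] (F : CommAlgCat.{u} k ⥤ CommRingCat.{u})
    (J : Type) where
  equiv (A : CommAlgCat.{u} k) : F.obj A ≃ (J → A)
  equiv_map {A A' : CommAlgCat.{u} k} (f : A ⟶ A') (x : F.obj A) (j : J) :
    equiv A' ((F.map f).hom x) j = f.hom (equiv A x j)

namespace Coordinates

variable {k : Type u} [Field k] {F G : CommAlgCat.{u} k ⥤ CommRingCat.{u}} {J : Type}

/-- The components of a Witt vector. -/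
def witt (p : ℕ) [Fact p.Prime] (k : Type u) [Field k] : Coordinates (wittFunctor p k) ℕ where
  equiv _ := ⟨WittVector.coeff, WittVector.mk p, fun _ => rfl, fun _ => rfl⟩
  equiv_map _ _ _ := rfl

/-- The components of a ramified Witt vector. -/
def ramWitt {R : Type u} [CommRing R] {p : ℕ} [Fact p.Prime] (D : WittDatum R p) (ρ : R →+* k) :
    Coordinates (ramWittFunctor D ρ) ℕ where
  equiv _ := ⟨RamWitt.coeff, RamWitt.mk, fun _ => rfl, fun _ => rfl⟩
  equiv_map _ _ _ := rfl

theorem isLevel_witt (p : ℕ) [Fact p.Prime] :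
    IsLevel (fun A => (witt p k).equiv A) id := fun _ _ _ _ =>
  WittVector.le_coeff_eq_iff_le_sub_coeff_eq_zero.symm

theorem isLevel_ramWitt {R : Type u} [CommRing R] {p : ℕ} [Fact p.Prime] {D : WittDatum R p}
    {ρ : R →+* k} (hρ : ρ D.ϖ = 0) : IsLevel (fun A => (ramWitt D ρ).equiv A) id := fun A N x y =>
  RamWitt.coeff_sub_eq_zero_iff ((congrArg (algebraMap k A) hρ).trans (map_zero _)) x y N

section Tensor

variable (c : Coordinates F J) {S O : Type u} [CommRing S] [CommRing O] (s : Scalars S F)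
  {ι : S →+* O} {I : Type} [Fintype I] {b : I → O}
  (hb : Function.Bijective fun a : I → S => ∑ i, ι (a i) * b i)

/-- The coordinates on `F(A) ⊗_S O` obtained from coordinates on `F` and a basis of `O` over `S`. -/
noncomputable def tensor : Coordinates (tensorFunctor s ι) (J × I) where
  equiv A := (TensorRing.piEquiv (s.hom A) hb).symm.toEquiv.trans
    ⟨fun x j => c.equiv A (x j.2) j.1, fun y i => (c.equiv A).symm fun j => y (j, i),
      fun x => funext fun i => (c.equiv A).symm_apply_apply (x i),
      fun y => funext fun j => congrFun ((c.equiv A).apply_symm_apply fun j' => y (j', j.2)) j.1⟩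
  equiv_map {A A'} f x j := by
    refine Eq.trans ?_ (c.equiv_map f _ j.1)
    exact congrArg (c.equiv A' · j.1)
      (TensorRing.piEquiv_symm_map hb (F.map f).hom (s.naturality f) x j.2)

theorem isLevel_tensor {c : Coordinates F J} {ℓ : J → ℕ} (hℓ : IsLevel (fun A => c.equiv A) ℓ) :
    IsLevel (fun A => (c.tensor s hb).equiv A) (fun j => ℓ j.1) := fun A N x y => by
  have hxy (i : I) := hℓ A N ((TensorRing.piEquiv (s.hom A) hb).symm x i)
    ((TensorRing.piEquiv (s.hom A) hb).symm y i)
  have hsub (j : J × I) : (c.tensor s hb).equiv A (x - y) j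
      = c.equiv A ((TensorRing.piEquiv (s.hom A) hb).symm x j.2
        - (TensorRing.piEquiv (s.hom A) hb).symm y j.2) j.1 :=
    congrArg (fun z : I → F.obj A => c.equiv A (z j.2) j.1)
      (map_sub (TensorRing.piEquiv (s.hom A) hb).symm x y)
  simp only [hsub]
  exact ⟨fun H j hj => (hxy j.2).1 (fun j' hj' => H (j', j.2) hj') j.1 hj,
    fun H j hj => (hxy j.2).2 (fun j' hj' => H (j', j.2) hj') j.1 hj⟩

theorem tensor_tensorMap (d : Coordinates G J) (t : Scalars S G) (τ : F ⟶ G)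
    (hτ : ∀ A x, (τ.app A).hom (s.hom A x) = t.hom A x) {N : J → ℕ}
    (hN : ∀ A x j, d.equiv A ((τ.app A).hom x) j = c.equiv A x j ^ N j)
    (A : CommAlgCat.{u} k) (x : (tensorFunctor s ι).obj A) (j : J × I) :
    (d.tensor t hb).equiv A (((tensorMap s t ι τ hτ).app A).hom x) j
      = (c.tensor s hb).equiv A x j ^ N j.1 := by
  refine Eq.trans ?_ (hN A _ j.1)
  exact congrArg (d.equiv A · j.1) (TensorRing.piEquiv_symm_map hb (τ.app A).hom (hτ A) x j.2)

theorem tensorLift_eq_zero_iff (t : Scalars O G) (τ : F ⟶ G)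
    (hτ : ∀ A x, (τ.app A).hom (s.hom A x) = t.hom A (ι x)) {m : J × I → ℕ}
    (hm : ∀ (A : CommAlgCat.{u} k) (x : I → F.obj A),
      ∑ i, (τ.app A).hom (x i) * t.hom A (b i) = 0 ↔ ∀ j i, c.equiv A (x i) j ^ m (j, i) = 0)
    (A : CommAlgCat.{u} k) (x : (tensorFunctor s ι).obj A) :
    ((tensorLift s ι t τ hτ).app A).hom x = 0 ↔
      ∀ j, (c.tensor s hb).equiv A x j ^ m j = 0 := by
  refine (Eq.congr_left (TensorRing.lift_eq_sum hb _ _ (hτ A) x)).trans ((hm A _).trans ?_)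
  exact ⟨fun H j => H j.1 j.2, fun H j i => H (j, i)⟩

end Tensor

end Coordinates

/-! ## Group functors with nilpotent coordinates -/

section NilRing

variable {k : Type u} [Field k] {J : Type} (m : J → ℕ)

/-- `k[X_j : j ∈ J] / (X_j ^ {m_j})`, the coordinate ring of a product of infinitesimal affine
lines. -/
abbrev NilRing (k : Type u) [Field k] {J : Type} (m : J → ℕ) : Type u :=
  MvPolynomial J k ⧸ Ideal.span (Set.range fun j : J => (MvPolynomial.X j : MvPolynomial J k) ^ m j)

namespace NilRing

/-- The class of the variable `X_j`. -/
noncomputable def X (j : J) : NilRing k m := Ideal.Quotient.mk _ (MvPolynomial.X j)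

theorem X_pow (j : J) : (X m j : NilRing k m) ^ m j = 0 :=
  Ideal.Quotient.eq_zero_iff_mem.2 (Ideal.subset_span ⟨j, rfl⟩)

variable {m}

theorem induction_on {P : NilRing k m → Prop} (algebraMap : ∀ a, P (algebraMap k _ a))
    (add : ∀ x y, P x → P y → P (x + y)) (mul_X : ∀ x j, P x → P (x * X m j)) (x : NilRing k m) :
    P x := by
  obtain ⟨f, rfl⟩ := Ideal.Quotient.mk_surjective x
  induction f using MvPolynomial.induction_on with
  | C a => exact algebraMap a
  | add f g hf hg => exact add _ _ hf hg
  | mul_X f j hf => exact mul_X _ j hf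

section Lift

variable {A : Type*} [CommRing A] [Algebra k A]

theorem algHom_ext {g g' : NilRing k m →ₐ[k] A} (h : ∀ j, g (X m j) = g' (X m j)) : g = g' :=
  Ideal.Quotient.algHom_ext _ (MvPolynomial.algHom_ext h)

variable (k) in
/-- The homomorphism `X_j ↦ y_j`. -/
noncomputable def lift (y : J → A) (hy : ∀ j, y j ^ m j = 0) : NilRing k m →ₐ[k] A :=
  Ideal.Quotient.liftₐ _ (MvPolynomial.aeval y) fun a ha => by
    have : Ideal.span (Set.range fun j : J => (MvPolynomial.X j : MvPolynomial J k) ^ m j)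
        ≤ RingHom.ker (MvPolynomial.aeval y : MvPolynomial J k →ₐ[k] A) := by
      rw [Ideal.span_le]
      rintro _ ⟨j, rfl⟩
      simp [hy]
    exact this ha

theorem lift_X (y : J → A) (hy : ∀ j, y j ^ m j = 0) (j : J) : lift k y hy (X m j) = y j :=
  MvPolynomial.aeval_X _ _

variable (k m A) in
/-- The universal property of `k[X_j] / (X_j ^ {m_j})`. -/
noncomputable def liftEquiv : {y : J → A // ∀ j, y j ^ m j = 0} ≃ (NilRing k m →ₐ[k] A) where
  toFun y := lift k y.1 y.2
  invFun g := ⟨fun j => g (X m j), fun j => by rw [← map_pow, X_pow, map_zero]⟩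
  left_inv y := Subtype.ext (funext (lift_X y.1 y.2))
  right_inv _ := algHom_ext fun j => lift_X _ _ j

end Lift

theorem isNilpotent_sub_algebraMap (φ : NilRing k m →ₐ[k] k) (hφ : ∀ j, φ (X m j) = 0)
    (x : NilRing k m) : IsNilpotent (x - algebraMap k (NilRing k m) (φ x)) := by
  induction x using induction_on with
  | algebraMap a =>
    rw [φ.commutes]
    exact (sub_self (algebraMap k (NilRing k m) a)).symm ▸ IsNilpotent.zero
  | add x y hx hy =>
    rw [map_add, map_add, add_sub_add_comm]
    exact (Commute.all _ _).isNilpotent_add hx hy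
  | mul_X x j _ =>
    rw [map_mul, hφ, mul_zero, map_zero, sub_zero]
    exact (Commute.all _ _).isNilpotent_mul_left ⟨m j, X_pow m j⟩

variable (hm : ∀ j, 0 < m j)
include hm

theorem module_finite [Finite J] : Module.Finite k (NilRing k m) := by
  have : Algebra.IsIntegral k (NilRing k m) := ⟨fun x => by
    induction x using induction_on with
    | algebraMap a => exact isIntegral_algebraMap
    | add x y hx hy => exact hx.add hy
    | mul_X x j hx => exact hx.mul (.of_pow (hm j) (by rw [X_pow]; exact isIntegral_zero))⟩
  have : Algebra.FiniteType k (NilRing k m) :=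
    Algebra.FiniteType.of_surjective (Ideal.Quotient.mkₐ k _) Ideal.Quotient.mk_surjective
  exact Algebra.IsIntegral.finite

theorem isLocalRing : IsLocalRing (NilRing k m) := by
  let φ : NilRing k m →ₐ[k] k := lift k 0 fun j => zero_pow (hm j).ne'
  have hφ := isNilpotent_sub_algebraMap φ (lift_X _ _)
  have : IsLocalHom (φ : NilRing k m →+* k) := ⟨fun x hx => by
    have hu : IsUnit (algebraMap k (NilRing k m) (φ x)) := hx.map (algebraMap k (NilRing k m))
    have := (hφ x).isUnit_add_left_of_commute hu (Commute.all _ _)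
    rwa [add_sub_cancel] at this⟩
  exact RingHom.domain_isLocalRing (φ : NilRing k m →+* k)

end NilRing

end NilRing

section NilCoords

variable {k : Type u} [Field k]

theorem isSpec_of_equiv {G : CommAlgCat.{u} k ⥤ AddCommGrpCat.{u}} {C : Type u} [CommRing C]
    [Algebra k C] (ε : ∀ A : CommAlgCat.{u} k, G.obj A ≃ (C →ₐ[k] A))
    (hε : ∀ {A A' : CommAlgCat.{u} k} (f : A ⟶ A') (x : G.obj A),
      ε A' (G.map f x) = f.hom.comp (ε A x)) : IsSpec G C := by
  let a (A : CommAlgCat.{u} k) : (C →ₐ[k] A) ≃ (points k (specOver k C)).obj A :=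
    ((⟨fun g => (CommAlgCat.ofHom g : CommAlgCat.of k C ⟶ A), fun g => g.hom,
      fun _ => rfl, fun _ => rfl⟩ : (C →ₐ[k] A) ≃ (CommAlgCat.of k C ⟶ A)).trans
      (opEquiv (Opposite.op A) (Opposite.op (CommAlgCat.of k C))).symm).trans
      (AlgebraicGeometry.algSpec.fullyFaithful (R := CommRingCat.of k)).homEquiv
  refine ⟨NatIso.ofComponents (fun A => ((ε A).trans (a A)).toIso) fun {A A'} f => ?_⟩
  ext x
  change a A' (ε A' (G.map f x)) = (points k (specOver k C)).map f (a A (ε A x))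
  rw [hε]
  exact (AlgebraicGeometry.algSpec (CommRingCat.of k)).map_comp f.op
    (CommAlgCat.ofHom (ε A x) : CommAlgCat.of k C ⟶ A).op

/-- Coordinates identifying a group functor, as a functor of sets, with
`A ↦ {y ∈ A ^ J | ∀ j, y_j ^ {m_j} = 0}`. -/
structure NilCoords (G : CommAlgCat.{u} k ⥤ AddCommGrpCat.{u}) {J : Type} (m : J → ℕ) where
  equiv (A : CommAlgCat.{u} k) : G.obj A ≃ {y : J → A // ∀ j, y j ^ m j = 0}
  equiv_map {A A' : CommAlgCat.{u} k} (f : A ⟶ A') (x : G.obj A) (j : J) :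
    (equiv A' (G.map f x)).1 j = f.hom ((equiv A x).1 j)

namespace NilCoords

variable {G : CommAlgCat.{u} k ⥤ AddCommGrpCat.{u}} {J : Type} {m : J → ℕ} (c : NilCoords G m)

/-- The coordinates of a point. -/
abbrev coord (A : CommAlgCat.{u} k) (x : G.obj A) : J → A := (c.equiv A x).1

theorem coord_injective (A : CommAlgCat.{u} k) : Function.Injective (c.coord A) :=
  Subtype.val_injective.comp (c.equiv A).injective

theorem exists_coord_eq {A : CommAlgCat.{u} k} {y : J → A} (hy : ∀ j, y j ^ m j = 0) :
    ∃ x, c.coord A x = y :=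
  ⟨(c.equiv A).symm ⟨y, hy⟩, congrArg Subtype.val ((c.equiv A).apply_symm_apply _)⟩

include c in
theorem isSpec : IsSpec G (NilRing k m) :=
  isSpec_of_equiv (fun A => (c.equiv A).trans (NilRing.liftEquiv k m A)) fun f x =>
    NilRing.algHom_ext fun j => (NilRing.lift_X _ (c.equiv _ (G.map f x)).2 j).trans
      ((c.equiv_map f x j).trans
        (congrArg f.hom (NilRing.lift_X (k := k) _ (c.equiv _ x).2 j).symm))

include c in
theorem isAffineGroup : IsAffineGroup G := ⟨CommAlgCat.of k (NilRing k m), c.isSpec⟩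

include c in
theorem isInfinitesimal [Finite J] (hm : ∀ j, 0 < m j) : IsInfinitesimal G :=
  ⟨CommAlgCat.of k (NilRing k m), NilRing.module_finite hm, NilRing.isLocalRing hm, c.isSpec⟩

/-- Renaming of the coordinates. -/
def reindex {J' : Type} {m' : J' → ℕ} (σ : J' ≃ J) (hm : ∀ j, m' j = m (σ j)) :
    NilCoords G m' where
  equiv A := (c.equiv A).trans <| (Equiv.arrowCongr σ.symm (Equiv.refl A)).subtypeEquiv fun y =>
    ⟨fun hy j => hm j ▸ hy (σ j), fun hy j => by simpa [hm] using hy (σ.symm j)⟩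
  equiv_map f x j := c.equiv_map f x (σ j)

/-- The coordinates of the components of a tuple of points. -/
def power (e : ℕ) : NilCoords (RamifiedWitt.power e G) fun j : J × Fin e => m j.1 where
  equiv A := (Equiv.piCongrRight fun _ => c.equiv A).trans
    ⟨fun y => ⟨fun j => (y j.2).1 j.1, fun j => (y j.2).2 j.1⟩,
      fun y i => ⟨fun j => y.1 (j, i), fun j => y.2 (j, i)⟩, fun _ => rfl, fun _ => rfl⟩
  equiv_map f x j := c.equiv_map f (x j.2) j.1

end NilCoords

/-- The coordinates on the kernel of a morphism of ring functors that is given, in terms of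
coordinates on its source, by nilpotency conditions. -/
def Coordinates.ker {F F' : CommAlgCat.{u} k ⥤ CommRingCat.{u}} {J : Type} {m : J → ℕ}
    (c : Coordinates F J) (τ : F ⟶ F')
    (hτ : ∀ A x, (τ.app A).hom x = 0 ↔ ∀ j, c.equiv A x j ^ m j = 0) :
    NilCoords (RamifiedWitt.ker τ) m where
  equiv A := (c.equiv A).subtypeEquiv (hτ A)
  equiv_map f x j := c.equiv_map f x.1 j

theorem Coordinates.isLevel_ker {F F' : CommAlgCat.{u} k ⥤ CommRingCat.{u}} {J : Type} {m : J → ℕ}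
    {c : Coordinates F J} {τ : F ⟶ F'}
    {hτ : ∀ A x, (τ.app A).hom x = 0 ↔ ∀ j, c.equiv A x j ^ m j = 0} {ℓ : J → ℕ}
    (hℓ : IsLevel (fun A => c.equiv A) ℓ) : IsLevel (c.ker τ hτ).coord ℓ := fun A N x y =>
  hℓ A N x.1 y.1

end NilCoords

/-! ## Truncations and pro-infinitesimal groups -/

namespace NilCoords

variable {k : Type u} [Field k] {G : CommAlgCat.{u} k ⥤ AddCommGrpCat.{u}} {J : Type} {m : J → ℕ}
  {c : NilCoords G m} {ℓ : J → ℕ} (hℓ : IsLevel c.coord ℓ)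

/-- The points whose coordinates of level `< N` vanish. -/
def levelSubgroup (N : ℕ) (A : CommAlgCat.{u} k) : AddSubgroup (G.obj A) :=
  AddSubgroup.ofSub {x | ∀ j, ℓ j < N → c.coord A x j = 0}
    ⟨0, by have := (hℓ A N 0 0).2 fun _ _ => rfl; rwa [sub_zero] at this⟩
    fun x hx y hy => by
      rw [← sub_eq_add_neg]
      exact (hℓ A N x y).2 fun j hj => (hx j hj).trans (hy j hj).symm

theorem mk_eq_mk_iff {N : ℕ} {A : CommAlgCat.{u} k} {x y : G.obj A} :
    (QuotientAddGroup.mk x : G.obj A ⧸ levelSubgroup hℓ N A) = QuotientAddGroup.mk y ↔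
      ∀ j, ℓ j < N → c.coord A x j = c.coord A y j :=
  QuotientAddGroup.eq_iff_sub_mem.trans (hℓ A N x y)

theorem levelSubgroup_le_comap (N : ℕ) {A A' : CommAlgCat.{u} k} (f : A ⟶ A') :
    levelSubgroup hℓ N A ≤ (levelSubgroup hℓ N A').comap (G.map f).hom := fun x hx j hj =>
  (c.equiv_map f x j).trans ((congrArg f.hom (hx j hj)).trans (map_zero _))

/-- The quotient of `G` by the points whose coordinates of level `< N` vanish. -/
noncomputable def trunc (N : ℕ) : CommAlgCat.{u} k ⥤ AddCommGrpCat.{u} where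
  obj A := AddCommGrpCat.of (G.obj A ⧸ levelSubgroup hℓ N A)
  map f := AddCommGrpCat.ofHom
    (QuotientAddGroup.map _ _ (G.map f).hom (levelSubgroup_le_comap hℓ N f))
  map_id A := by
    refine AddCommGrpCat.hom_ext
      (QuotientAddGroup.addMonoidHom_ext _ (AddMonoidHom.ext fun x => ?_))
    exact congrArg QuotientAddGroup.mk (ConcreteCategory.congr_hom (G.map_id A) x)
  map_comp f g := by
    refine AddCommGrpCat.hom_ext
      (QuotientAddGroup.addMonoidHom_ext _ (AddMonoidHom.ext fun x => ?_))
    exact congrArg QuotientAddGroup.mk (ConcreteCategory.congr_hom (G.map_comp f g) x)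

/-- The coordinates of level `< N`, on the truncation at level `N`. -/
noncomputable def truncCoords (N : ℕ) :
    NilCoords (trunc hℓ N) fun j : {j : J // ℓ j < N} => m j.1 where
  equiv A := .ofBijective
    (Quotient.lift (fun x => ⟨fun j => c.coord A x j.1, fun j => (c.equiv A x).2 j.1⟩)
      fun x y hxy => Subtype.ext (funext fun j =>
        (mk_eq_mk_iff hℓ).1 (Quotient.sound hxy) j.1 j.2))
    ⟨Quotient.ind₂ fun x y hxy => (mk_eq_mk_iff hℓ).2 fun j hj =>
      congrFun (congrArg Subtype.val hxy) ⟨j, hj⟩, fun y => by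
      classical
      obtain ⟨x, hx⟩ := c.exists_coord_eq
        (y := fun j => if hj : ℓ j < N then y.1 ⟨j, hj⟩ else c.coord A 0 j) fun j => by
          split_ifs with hj
          · exact y.2 ⟨j, hj⟩
          · exact (c.equiv A 0).2 j
      exact ⟨QuotientAddGroup.mk x, Subtype.ext (funext fun j =>
        (congrFun hx j.1).trans (dif_pos j.2))⟩⟩
  equiv_map f := Quotient.ind fun x j => c.equiv_map f x j.1

/-- The tower of truncations. -/
noncomputable def tower : (ULift.{u} ℕ)ᵒᵖ ⥤ CommAlgCat.{u} k ⥤ AddCommGrpCat.{u} where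
  obj N := trunc hℓ N.unop.down
  map {N M} f :=
    { app := fun _ => AddCommGrpCat.ofHom (QuotientAddGroup.map _ _ (AddMonoidHom.id _)
        fun _ hx j hj => hx j (hj.trans_le (leOfHom f.unop :)))
      naturality := fun _ _ _ => AddCommGrpCat.hom_ext
        (QuotientAddGroup.addMonoidHom_ext _ (AddMonoidHom.ext fun _ => rfl)) }
  map_id N := by
    ext A : 2
    exact AddCommGrpCat.hom_ext
      (QuotientAddGroup.addMonoidHom_ext _ (AddMonoidHom.ext fun _ => rfl))
  map_comp f g := by
    ext A : 2
    exact AddCommGrpCat.hom_ext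
      (QuotientAddGroup.addMonoidHom_ext _ (AddMonoidHom.ext fun _ => rfl))

/-- The projections of `G` to its truncations. -/
noncomputable def towerCone : Limits.Cone (tower hℓ) where
  pt := G
  π :=
    { app := fun _ =>
        { app := fun _ => AddCommGrpCat.ofHom (QuotientAddGroup.mk' _)
          naturality := fun _ _ _ => rfl }
      naturality := fun _ _ _ => rfl }

theorem existsUnique_mk_eq (A : CommAlgCat.{u} k) (g : ℕ → G.obj A)
    (hg : ∀ N M, M ≤ N → ∀ j, ℓ j < M → c.coord A (g N) j = c.coord A (g M) j) :
    ∃! x, ∀ N, (QuotientAddGroup.mk x : G.obj A ⧸ levelSubgroup hℓ N A)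
      = QuotientAddGroup.mk (g N) := by
  obtain ⟨x, hx⟩ := c.exists_coord_eq (y := fun j => c.coord A (g (ℓ j + 1)) j)
    fun j => (c.equiv A (g (ℓ j + 1))).2 j
  refine ⟨x, fun N => (mk_eq_mk_iff hℓ).2 fun j hj => ?_, fun x' hx' => ?_⟩
  · exact (congrFun hx j).trans (hg N (ℓ j + 1) hj j (Nat.lt_succ_self _)).symm
  · refine c.coord_injective A (funext fun j => ?_)
    exact ((mk_eq_mk_iff hℓ).1 (hx' (ℓ j + 1)) j (Nat.lt_succ_self _)).trans (congrFun hx j).symm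

theorem nonempty_isLimit_towerCone : Nonempty (Limits.IsLimit (towerCone hℓ)) := by
  refine ⟨Limits.evaluationJointlyReflectsLimits _ fun A => ?_⟩
  refine Limits.isLimitOfReflects (forget AddCommGrpCat.{u}) ?_
  refine Classical.choice ((Limits.Types.isLimit_iff _).2 fun s hs => ?_)
  choose g hg using fun N : ℕ => QuotientAddGroup.mk_surjective
    (s := levelSubgroup hℓ N A) (s (Opposite.op ⟨N⟩))
  have hcompat : ∀ N M, M ≤ N → ∀ j, ℓ j < M → c.coord A (g N) j = c.coord A (g M) j :=
    fun N M hMN => (mk_eq_mk_iff hℓ).1 <| by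
      have hs := hs (homOfLE (show (⟨M⟩ : ULift.{u} ℕ) ≤ ⟨N⟩ from hMN)).op
      refine Eq.trans ?_ (hs.trans (hg M).symm)
      rw [← hg N]
      rfl
  obtain ⟨x, hx, hunique⟩ := existsUnique_mk_eq hℓ A g hcompat
  exact ⟨x, fun N => (hx N.unop.down).trans (hg _), fun x' hx' =>
    hunique x' fun N => (hx' (Opposite.op ⟨N⟩)).trans (hg N).symm⟩

include hℓ in
theorem isProInfinitesimal (hm : ∀ j, 0 < m j) (hfin : ∀ N, Finite {j : J // ℓ j < N}) :
    IsProInfinitesimal G :=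
  ⟨(ULift.{u} ℕ)ᵒᵖ, inferInstance, inferInstance, tower hℓ, towerCone hℓ,
    fun N => have := hfin N.unop.down
      (truncCoords hℓ N.unop.down).isInfinitesimal fun j => hm j.1,
    nonempty_isLimit_towerCone hℓ, ⟨Iso.refl _⟩⟩

end NilCoords

/-! ## Adjoining roots by faithfully flat extensions -/

section Roots

open MvPolynomial
open scoped TensorProduct

section Exponents

variable {J : Type*} {N : J → ℕ}

theorem smul_add_eq_smul_add_iff {c d r s : J →₀ ℕ} (hr : ∀ j, r j < N j) (hs : ∀ j, s j < N j) :
    N • c + r = N • d + s ↔ r = s ∧ c = d := by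
  refine ⟨fun h => ?_, fun ⟨hrs, hcd⟩ => hrs ▸ hcd ▸ rfl⟩
  have hj : ∀ j, N j * c j + r j = N j * d j + s j := fun j => DFunLike.congr_fun h j
  have hN : ∀ j, 0 < N j := fun j => (Nat.zero_le _).trans_lt (hr j)
  constructor <;> ext j
  · simpa [Nat.mul_add_mod, Nat.mod_eq_of_lt (hr j), Nat.mod_eq_of_lt (hs j)]
      using congrArg (· % N j) (hj j)
  · simpa [Nat.mul_add_div (hN j), Nat.div_eq_of_lt (hr j), Nat.div_eq_of_lt (hs j)]
      using congrArg (· / N j) (hj j)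

theorem exists_smul_add_eq (hN : ∀ j, 0 < N j) (d : J →₀ ℕ) :
    ∃ c r : J →₀ ℕ, (∀ j, r j < N j) ∧ N • c + r = d := by
  refine ⟨.onFinset d.support (fun j => d j / N j) fun j hj => ?_,
    .onFinset d.support (fun j => d j % N j) fun j hj => ?_, fun j => Nat.mod_lt _ (hN j),
    Finsupp.ext fun j => Nat.div_add_mod (d j) (N j)⟩
  · exact Finsupp.mem_support_iff.2 fun h => hj (by rw [h, Nat.zero_div])
  · exact Finsupp.mem_support_iff.2 fun h => hj (by rw [h, Nat.zero_mod])

end Exponents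

/-- The ring `k[X_j]`, regarded as an algebra over `k[X_j]` through `X_j ↦ X_j ^ {N_j}`: the
universal extension in which the variables have roots. -/
def RootRing (k : Type*) [CommRing k] {J : Type*} (_N : J → ℕ) := MvPolynomial J k

variable {k : Type*} [CommRing k] {J : Type*} {N : J → ℕ}

variable (k N) in
/-- The endomorphism `X_j ↦ X_j ^ {N_j}` of `k[X_j]`. -/
noncomputable def powHom : MvPolynomial J k →ₐ[k] MvPolynomial J k :=
  aeval fun j => X j ^ N j

theorem powHom_monomial (d : J →₀ ℕ) (a : k) :
    powHom k N (monomial d a) = monomial (N • d) a := by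
  classical
  rw [powHom, aeval_monomial, monomial_eq, algebraMap_eq, Finsupp.prod,
    Finsupp.prod_of_support_subset (s := d.support) _ (fun j hj => ?_) _ fun _ _ => pow_zero _]
  · simp only [← pow_mul, Finsupp.coe_pointwise_smul, Pi.smul_apply', smul_eq_mul]
  · rw [Finsupp.mem_support_iff] at hj ⊢
    exact right_ne_zero_of_mul hj

open Classical in
theorem coeff_powHom_mul_monomial (f : MvPolynomial J k) (d : J →₀ ℕ) {r s : J →₀ ℕ}
    (hr : ∀ j, r j < N j) (hs : ∀ j, s j < N j) :
    coeff (N • d + s) (powHom k N f * monomial r 1) = if r = s then coeff d f else 0 := by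
  induction f using MvPolynomial.induction_on' with
  | monomial c a =>
    rw [powHom_monomial, monomial_mul, mul_one, coeff_monomial, coeff_monomial,
      if_congr (smul_add_eq_smul_add_iff hr hs) rfl rfl, ite_and]
  | add f g hf hg =>
    rw [map_add, add_mul, coeff_add, hf, hg, coeff_add, ite_add_zero]

namespace RootRing

noncomputable instance : CommRing (RootRing k N) := inferInstanceAs (CommRing (MvPolynomial J k))

instance [Nontrivial k] : Nontrivial (RootRing k N) :=
  inferInstanceAs (Nontrivial (MvPolynomial J k))

noncomputable instance : Algebra (MvPolynomial J k) (RootRing k N) :=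
  (powHom k N : MvPolynomial J k →+* MvPolynomial J k).toAlgebra

variable (k N) in
/-- The variable `X_j`, an `N_j`-th root of the scalar `X_j`. -/
noncomputable def root (j : J) : RootRing k N := (X j : MvPolynomial J k)

theorem root_pow (j : J) : root k N j ^ N j = algebraMap (MvPolynomial J k) _ (X j) :=
  (aeval_X (R := k) (fun j => (X j : MvPolynomial J k) ^ N j) j).symm

variable (k N) in
/-- The monomials with exponents `r_j < N_j`, a basis of `RootRing k N`. -/
noncomputable def reducedMonomial (r : {r : J →₀ ℕ // ∀ j, r j < N j}) : RootRing k N :=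
  (monomial r.1 1 : MvPolynomial J k)

theorem smul_reducedMonomial (f : MvPolynomial J k) (r : {r : J →₀ ℕ // ∀ j, r j < N j}) :
    f • reducedMonomial k N r = (powHom k N f * monomial r.1 1 : MvPolynomial J k) := rfl

theorem linearIndependent_reducedMonomial :
    LinearIndependent (MvPolynomial J k) (reducedMonomial k N) := by
  classical
  refine linearIndependent_iff'.2 fun s g hg r hr => MvPolynomial.ext _ _ fun d => ?_
  have hsum : ∑ i ∈ s, powHom k N (g i) * monomial i.1 1 = 0 := hg
  have hcoeff := congrArg (coeff (N • d + r.1)) hsum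
  rw [coeff_sum, Finset.sum_congr rfl fun i _ => coeff_powHom_mul_monomial (g i) d i.2 r.2,
    Finset.sum_eq_single_of_mem r hr fun i _ hi => if_neg fun h => hi (Subtype.ext h),
    if_pos rfl] at hcoeff
  exact hcoeff

theorem mem_span_reducedMonomial (hN : ∀ j, 0 < N j) (f : RootRing k N) :
    f ∈ Submodule.span (MvPolynomial J k) (Set.range (reducedMonomial k N)) := by
  change MvPolynomial J k at f
  induction f using MvPolynomial.induction_on' with
  | monomial d a =>
    obtain ⟨c, r, hr, rfl⟩ := exists_smul_add_eq hN d
    have hmul : (monomial (N • c + r) a : MvPolynomial J k)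
        = (monomial c a • reducedMonomial k N ⟨r, hr⟩ : RootRing k N) := by
      rw [smul_reducedMonomial, powHom_monomial, monomial_mul, mul_one]
    exact hmul ▸ Submodule.smul_mem _ _ (Submodule.subset_span ⟨_, rfl⟩)
  | add f g hf hg => exact Submodule.add_mem _ hf hg

theorem free (hN : ∀ j, 0 < N j) : Module.Free (MvPolynomial J k) (RootRing k N) :=
  .of_basis (.mk linearIndependent_reducedMonomial fun f _ => mem_span_reducedMonomial hN f)

end RootRing

theorem exists_faithfullyFlat_roots {k : Type u} [Field k] {J : Type} {N : J → ℕ}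
    (hN : ∀ j, 0 < N j) (A : CommAlgCat.{u} k) (a : J → A) :
    ∃ (A' : CommAlgCat.{u} k) (f : A ⟶ A'), (f.hom : A →+* A').FaithfullyFlat ∧
      ∃ b : J → A', ∀ j, b j ^ N j = f.hom (a j) := by
  let := (aeval a : MvPolynomial J k →ₐ[k] A).toRingHom.toAlgebra
  have := RootRing.free (k := k) hN
  let T := A ⊗[MvPolynomial J k] RootRing k N
  have hflat : (algebraMap A T).FaithfullyFlat :=
    RingHom.faithfullyFlat_algebraMap_iff.2 inferInstance
  let : Algebra k T := ((algebraMap A T).comp (algebraMap k A)).toAlgebra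
  let f : A →ₐ[k] T := { algebraMap A T with commutes' := fun _ => rfl }
  refine ⟨CommAlgCat.of k T, CommAlgCat.ofHom f, hflat,
    fun j => (1 : A) ⊗ₜ[MvPolynomial J k] RootRing.root k N j, fun j => ?_⟩
  calc ((1 : A) ⊗ₜ[MvPolynomial J k] RootRing.root k N j : T) ^ N j
      = 1 ⊗ₜ algebraMap _ _ (X j) := by
        rw [Algebra.TensorProduct.tmul_pow, one_pow, RootRing.root_pow]
    _ = algebraMap _ A (X j) ⊗ₜ 1 := (Algebra.TensorProduct.tmul_one_eq_one_tmul _).symm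
    _ = a j ⊗ₜ 1 := congrArg (· ⊗ₜ[MvPolynomial J k] (1 : RootRing k N)) (aeval_X a j)

end Roots

section LocalLift

variable {k : Type u} [Field k] {F G : CommAlgCat.{u} k ⥤ CommRingCat.{u}} {J : Type}

theorem Coordinates.exists_faithfullyFlat_app_eq (c : Coordinates F J) (d : Coordinates G J)
    (σ : F ⟶ G) {N : J → ℕ} (hσ : ∀ A x j, d.equiv A ((σ.app A).hom x) j = c.equiv A x j ^ N j)
    (hN : ∀ j, 0 < N j) (A : CommAlgCat.{u} k) (y : G.obj A) :
    ∃ (A' : CommAlgCat.{u} k) (f : A ⟶ A'), (f.hom : A →+* A').FaithfullyFlat ∧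
      ∃ x, (σ.app A').hom x = (G.map f).hom y := by
  obtain ⟨A', f, hf, b, hb⟩ := exists_faithfullyFlat_roots hN A (d.equiv A y)
  refine ⟨A', f, hf, (c.equiv A').symm b, (d.equiv A').injective (funext fun j => ?_)⟩
  rw [hσ, Equiv.apply_symm_apply, hb]
  exact (d.equiv_map f y j).symm

end LocalLift

/-! ## The kernel of a composite -/

section Kernel

variable {k : Type u} [Field k] {F G F' G' H : CommAlgCat.{u} k ⥤ CommRingCat.{u}}

/-- The morphism induced on kernels by a commutative square. -/
noncomputable def kerMap {σ : F ⟶ G} {τ : F' ⟶ G'} (α : F ⟶ F') (β : G ⟶ G')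
    (h : α ≫ τ = σ ≫ β) : ker σ ⟶ ker τ where
  app A := AddCommGrpCat.ofHom
    { toFun := fun x => ⟨(α.app A).hom x.1, by
        have hx : (σ.app A).hom x.1 = 0 := x.2
        have hsq := ConcreteCategory.congr_hom (NatTrans.congr_app h A) x.1
        exact hsq.trans ((congrArg (β.app A).hom hx).trans (map_zero _))⟩
      map_zero' := Subtype.ext (map_zero (α.app A).hom)
      map_add' := fun x y => Subtype.ext (map_add (α.app A).hom x.1 y.1) }
  naturality A A' f := by
    refine AddCommGrpCat.hom_ext (AddMonoidHom.ext fun x => Subtype.ext ?_)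
    exact ConcreteCategory.congr_hom (α.naturality f) x.1

theorem isExtension_kerMap {σ : F ⟶ G} {τ : G ⟶ H} {ρ : F ⟶ H} (hρ : σ ≫ τ = ρ)
    {N : CommAlgCat.{u} k ⥤ AddCommGrpCat.{u}} (α : N ⟶ ker σ)
    (hα : ∀ A, Function.Bijective (α.app A)) (affine_left : IsAffineGroup N)
    (affine_middle : IsAffineGroup (ker ρ)) (affine_right : IsAffineGroup (ker τ))
    (hσ : ∀ A (y : G.obj A), ∃ (A' : CommAlgCat.{u} k) (f : A ⟶ A'),
      (f.hom : A →+* A').FaithfullyFlat ∧ ∃ x, (σ.app A').hom x = (G.map f).hom y) :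
    IsExtension (α ≫ kerMap (𝟙 F) τ ((Category.id_comp ρ).trans hρ.symm))
      (kerMap σ (𝟙 H) (hρ.trans (Category.comp_id ρ).symm)) where
  affine_left := affine_left
  affine_middle := affine_middle
  affine_right := affine_right
  injective A x y hxy := (hα A).1 (Subtype.ext (congrArg Subtype.val hxy :))
  exact A g := by
    constructor
    · intro hg
      obtain ⟨n, hn⟩ := (hα A).2 ⟨g.1, (congrArg Subtype.val hg :)⟩
      exact ⟨n, Subtype.ext (congrArg Subtype.val hn :)⟩
    · rintro ⟨n, rfl⟩
      exact Subtype.ext (α.app A n).2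
  surjective A y := by
    obtain ⟨A', f, hf, x, hx⟩ := hσ A y.1
    have hτ : (τ.app A').hom ((G.map f).hom y.1) = 0 := ((ker τ).map f y).2
    have hρx : (ρ.app A').hom x = 0 := by
      rw [← hρ]
      exact (congrArg (τ.app A').hom hx).trans hτ
    exact ⟨A', f, hf, ⟨x, hρx⟩, Subtype.ext hx⟩

end Kernel

section KernelTensor

variable {k : Type u} [Field k] {F G : CommAlgCat.{u} k ⥤ CommRingCat.{u}} {S O : Type u}
  [CommRing S] [CommRing O] (s : Scalars S F) (t : Scalars S G) {ι : S →+* O} {e : ℕ}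
  {b : Fin e → O} (hb : Function.Bijective fun a : Fin e → S => ∑ i, ι (a i) * b i)
  (σ : F ⟶ G) (hσ : ∀ A x, (σ.app A).hom (s.hom A x) = t.hom A x)

theorem tensorMap_piEquiv_eq_zero_iff (A : CommAlgCat.{u} k) (x : Fin e → F.obj A) :
    ((tensorMap s t ι σ hσ).app A).hom (TensorRing.piEquiv (s.hom A) hb x) = 0
      ↔ ∀ i, (σ.app A).hom (x i) = 0 :=
  (Eq.congr_left (TensorRing.map_piEquiv hb (σ.app A).hom (hσ A) x)).trans
    ((map_eq_zero_iff _ (TensorRing.piEquiv (t.hom A) hb).injective).trans funext_iff)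

/-- The morphism `(x_i) ↦ ∑ x_i ⊗ b_i`, for a basis `b` of `O` over `S`. -/
noncomputable def powerKerTensor : power e (ker σ) ⟶ ker (tensorMap s t ι σ hσ) where
  app A := AddCommGrpCat.ofHom
    { toFun := fun x => ⟨TensorRing.piEquiv (s.hom A) hb fun i => (x i).1,
        (tensorMap_piEquiv_eq_zero_iff s t hb σ hσ A _).2 fun i => (x i).2⟩
      map_zero' := Subtype.ext (map_zero (TensorRing.piEquiv (s.hom A) hb))
      map_add' := fun x y => Subtype.ext
        (map_add (TensorRing.piEquiv (s.hom A) hb) (fun i => (x i).1) fun i => (y i).1) }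
  naturality A A' f := by
    refine AddCommGrpCat.hom_ext (AddMonoidHom.ext fun x => Subtype.ext ?_)
    exact (TensorRing.map_piEquiv hb (F.map f).hom (s.naturality f) fun i => (x i).1).symm

theorem powerKerTensor_bijective (A : CommAlgCat.{u} k) :
    Function.Bijective ((powerKerTensor s t hb σ hσ).app A) := by
  refine ⟨fun x y hxy => ?_, fun z => ?_⟩
  · have := (TensorRing.piEquiv (s.hom A) hb).injective (congrArg Subtype.val hxy)
    exact funext fun i => Subtype.ext (congrFun this i)
  · obtain ⟨x, hx⟩ := (TensorRing.piEquiv (s.hom A) hb).surjective z.1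
    have hz : ((tensorMap s t ι σ hσ).app A).hom (TensorRing.piEquiv (s.hom A) hb x) = 0 := by
      rw [hx]
      exact z.2
    exact ⟨fun i => ⟨x i, (tensorMap_piEquiv_eq_zero_iff s t hb σ hσ A x).1 hz i⟩,
      Subtype.ext hx⟩

end KernelTensor

/-! ## The kernels of the Drinfeld morphisms and of `r` -/

section Comparison

open IsLocalRing

variable {O : Type u} [CommRing O] [IsDomain O] [IsDiscreteValuationRing O] {p h : ℕ}
  [Fact p.Prime] {π : O} (hπ : Irreducible π) (hk : Nat.card (ResidueField O) = p ^ h)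

theorem constantCoeff_uniformizer_eq_zero :
    (WittVector.constantCoeff : WittVector p (ResidueField O) →+* _) (wittDatum hk).ϖ = 0 :=
  have := charP_of_card hk
  (map_natCast _ p).trans (CharP.cast_eq_zero _ p)

theorem drinfeldO₀_scalar (A : CommAlgCat.{u} (ResidueField O))
    (s : WittVector p (ResidueField O)) :
    ((drinfeldO₀ hk).app A).hom ((wittScalars p (ResidueField O)).hom A s)
      = (ramWittScalars (wittDatum hk) WittVector.constantCoeff).hom A s := by
  have hs := congrArg (RamWitt.map
    (φ' := (algebraMap (ResidueField O) A).comp WittVector.constantCoeff)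
    (algebraMap (ResidueField O) A) rfl) (typicalDrinfeld_wittDatum hk s)
  rw [RamWitt.map_scalarHom, map_typicalDrinfeld] at hs
  exact hs

theorem coeff_drinfeldO₀ (A : CommAlgCat.{u} (ResidueField O)) (x : WittVector p A) (n : ℕ) :
    RamWitt.coeff (((drinfeldO₀ hk).app A).hom x) n = x.coeff n ^ p ^ (n * (h - 1)) :=
  coeff_typicalDrinfeld (D := wittDatum hk) rfl
    ((congrArg (algebraMap _ A) (constantCoeff_uniformizer_eq_zero hk)).trans (map_zero _)) x n

theorem drinfeldO₀_eq_zero_iff (A : CommAlgCat.{u} (ResidueField O)) (x : WittVector p A) :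
    ((drinfeldO₀ hk).app A).hom x = 0 ↔ ∀ n, x.coeff n ^ p ^ (n * (h - 1)) = 0 := by
  simp only [← coeff_drinfeldO₀ hk]
  exact ⟨fun hx n => congrArg (RamWitt.coeff · n) hx, fun hx => RamWitt.ext (funext hx)⟩

/-- The Witt components on the kernel of the Drinfeld morphism. -/
noncomputable def coordsKerDrinfeldO₀ :
    NilCoords (ker (drinfeldO₀ hk)) fun n : ℕ => p ^ (n * (h - 1)) :=
  (Coordinates.witt p (ResidueField O)).ker (drinfeldO₀ hk) (drinfeldO₀_eq_zero_iff hk)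

theorem isProInfinitesimal_ker_drinfeldO₀ : IsProInfinitesimal (ker (drinfeldO₀ hk)) :=
  have := charP_of_card hk
  NilCoords.isProInfinitesimal (c := coordsKerDrinfeldO₀ hk)
    (Coordinates.isLevel_ker (Coordinates.isLevel_witt p))
    (fun _ => pow_pos (Fact.out : p.Prime).pos _) fun N => (Set.finite_lt_nat N).to_subtype

theorem residue_uniformizer_eq_zero : residue O (dvrDatum hπ hk).ϖ = 0 :=
  (dvrDatum_residue hπ hk _).2 dvd_rfl

variable [IsAdicComplete (maximalIdeal O) O]

/-- The base change `u ⊗ O : W(A) ⊗_{W(k)} O → W_{O₀}(A) ⊗_{O₀} O` of the Drinfeld morphism. -/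
noncomputable def toRamTensor : greenberg hπ hk ⟶ ramTensor hπ hk :=
  tensorMap _ _ _ (drinfeldO₀ hk) (drinfeldO₀_scalar hk)

theorem drinfeldRam_drinfeldO₀ (A : CommAlgCat.{u} (ResidueField O)) (x : WittVector p A) :
    ((drinfeldRam hπ hk).app A).hom (((drinfeldO₀ hk).app A).hom x)
      = ((drinfeldO hπ hk).app A).hom x :=
  drinfeld_typicalDrinfeld (homO₀ hπ hk) (comp_homO₀ hπ hk A) x

theorem drinfeldO_scalar (A : CommAlgCat.{u} (ResidueField O))
    (s : WittVector p (ResidueField O)) :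
    ((drinfeldO hπ hk).app A).hom ((wittScalars p (ResidueField O)).hom A s)
      = (ramWittScalars (dvrDatum hπ hk) (residue O)).hom A (embO₀ hπ hk s) := by
  refine (drinfeldRam_drinfeldO₀ hπ hk A _).symm.trans ?_
  rw [drinfeldO₀_scalar]
  exact RamWitt.drinfeld_scalarHom (homO₀ hπ hk) (comp_homO₀ hπ hk A) s

theorem toRamTensor_comp_uRam : toRamTensor hπ hk ≫ uRam hπ hk = r hπ hk := by
  refine (tensorMap_comp_tensorLift _ _ _ _ _ _ _ _ fun A s => ?_).trans ?_
  · exact (drinfeldRam_drinfeldO₀ hπ hk A _).trans (drinfeldO_scalar hπ hk A s)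
  · unfold r
    congr 1
    ext A : 2
    exact CommRingCat.hom_ext (RingHom.ext (drinfeldRam_drinfeldO₀ hπ hk A))

theorem toGreenberg_comp_r : toGreenberg hπ hk ≫ r hπ hk = drinfeldO hπ hk := by
  ext A : 2
  refine CommRingCat.hom_ext (RingHom.ext fun b => ?_)
  refine (TensorRing.lift_tmul _ _ (drinfeldO_scalar hπ hk A) b 1).trans ?_
  rw [map_one, mul_one]

variable [CharZero O] {e : ℕ} (he : IsDiscreteValuationRing.addVal O (p : O) = e)

/-- The components on `W(A) ⊗_{W(k)} O` with respect to the basis `1, π, …, π ^ (e - 1)`. -/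
noncomputable def coordsGreenberg : Coordinates (greenberg hπ hk) (ℕ × Fin e) :=
  (Coordinates.witt p (ResidueField O)).tensor _ (sum_embO₀_mul_pow_bijective hπ hk he)

/-- The components on `W_{O₀}(A) ⊗_{O₀} O` with respect to the basis `1, π, …, π ^ (e - 1)`. -/
noncomputable def coordsRamTensor : Coordinates (ramTensor hπ hk) (ℕ × Fin e) :=
  (Coordinates.ramWitt (wittDatum hk) WittVector.constantCoeff).tensor _
    (sum_embO₀_mul_pow_bijective hπ hk he)

theorem coordsRamTensor_toRamTensor (A : CommAlgCat.{u} (ResidueField O))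
    (x : (greenberg hπ hk).obj A) (j : ℕ × Fin e) :
    (coordsRamTensor hπ hk he).equiv A (((toRamTensor hπ hk).app A).hom x) j
      = (coordsGreenberg hπ hk he).equiv A x j ^ p ^ (j.1 * (h - 1)) :=
  Coordinates.tensor_tensorMap (c := Coordinates.witt p (ResidueField O)) _
    (sum_embO₀_mul_pow_bijective hπ hk he)
    (Coordinates.ramWitt (wittDatum hk) WittVector.constantCoeff) _ (drinfeldO₀ hk)
    (drinfeldO₀_scalar hk) (N := fun n => p ^ (n * (h - 1))) (coeff_drinfeldO₀ hk) A x j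

theorem uRam_eq_zero_iff (A : CommAlgCat.{u} (ResidueField O)) (x : (ramTensor hπ hk).obj A) :
    ((uRam hπ hk).app A).hom x = 0 ↔ ∀ j, (coordsRamTensor hπ hk he).equiv A x j
      ^ (p ^ h) ^ (j.1 * (e - 1) + (j.2 : ℕ)) = 0 := by
  refine Coordinates.tensorLift_eq_zero_iff _ _ _ _ _ _ (fun A x => ?_) A x
  have := ramificationIndex_neZero hπ hk he
  obtain ⟨ε, hε⟩ := exists_unit_mul_pow hπ he
  have hx := RamWitt.sum_drinfeld_mul_scalarHom_pow_eq_zero_iff (homO₀ hπ hk)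
    (comp_homO₀ hπ hk A) ((map_natCast (embO₀ hπ hk) p).trans hε) ε.isUnit
    ((congrArg (algebraMap _ A) (residue_uniformizer_eq_zero hπ hk)).trans (map_zero _)) x
  simp only [show (homO₀ hπ hk).r = 1 from rfl, one_mul] at hx
  exact hx

theorem r_eq_zero_iff (A : CommAlgCat.{u} (ResidueField O)) (x : (greenberg hπ hk).obj A) :
    ((r hπ hk).app A).hom x = 0 ↔ ∀ j, (coordsGreenberg hπ hk he).equiv A x j
      ^ p ^ (j.1 * (h * e - 1) + h * (j.2 : ℕ)) = 0 := by
  refine Coordinates.tensorLift_eq_zero_iff _ _ _ _ _ _ (fun A x => ?_) A x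
  have := ramificationIndex_neZero hπ hk he
  obtain ⟨ε, hε⟩ := exists_unit_mul_pow hπ he
  exact sum_typicalDrinfeld_mul_scalarHom_pow_eq_zero_iff hε ε.isUnit
    ((congrArg (algebraMap _ A) (residue_uniformizer_eq_zero hπ hk)).trans (map_zero _)) x

/-- The components on the kernel of `u^ra`. -/
noncomputable def coordsKerURam : NilCoords (ker (uRam hπ hk))
    fun j : ℕ × Fin e => (p ^ h) ^ (j.1 * (e - 1) + (j.2 : ℕ)) :=
  (coordsRamTensor hπ hk he).ker (uRam hπ hk) (uRam_eq_zero_iff hπ hk he)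

/-- The components on the kernel of `r`. -/
noncomputable def coordsKerR : NilCoords (ker (r hπ hk))
    fun j : ℕ × Fin e => p ^ (j.1 * (h * e - 1) + h * (j.2 : ℕ)) :=
  (coordsGreenberg hπ hk he).ker (r hπ hk) (r_eq_zero_iff hπ hk he)

include he in
theorem isProInfinitesimal_ker_uRam : IsProInfinitesimal (ker (uRam hπ hk)) := by
  refine NilCoords.isProInfinitesimal (c := coordsKerURam hπ hk he)
    (Coordinates.isLevel_ker (Coordinates.isLevel_tensor _ _
      (Coordinates.isLevel_ramWitt (constantCoeff_uniformizer_eq_zero hk))))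
    (fun _ => pow_pos (pow_pos (Fact.out : p.Prime).pos _) _) fun N => Set.Finite.to_subtype ?_
  exact ((Set.finite_lt_nat N).prod (Set.finite_univ (α := Fin e))).subset
    fun j hj => ⟨hj, Set.mem_univ _⟩

include he in
theorem exists_isExtension_ker :
    ∃ (i : power e (ker (drinfeldO₀ hk)) ⟶ ker (r hπ hk)) (j : ker (r hπ hk) ⟶ ker (uRam hπ hk)),
      IsExtension i j :=
  ⟨_, _, isExtension_kerMap (toRamTensor_comp_uRam hπ hk)
    (powerKerTensor _ _ (sum_embO₀_mul_pow_bijective hπ hk he) _ (drinfeldO₀_scalar hk))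
    (powerKerTensor_bijective _ _ _ _ _) ((coordsKerDrinfeldO₀ hk).power e).isAffineGroup
    (coordsKerR hπ hk he).isAffineGroup (coordsKerURam hπ hk he).isAffineGroup
    ((coordsGreenberg hπ hk he).exists_faithfullyFlat_app_eq (coordsRamTensor hπ hk he) _
      (coordsRamTensor_toRamTensor hπ hk he) fun _ => pow_pos (Fact.out : p.Prime).pos _)⟩

end Comparison

/-! ## The unramified and the totally ramified case -/

section SpecialCases

open IsLocalRing

variable {O : Type u} [CommRing O] [IsDomain O] [IsDiscreteValuationRing O] {p h : ℕ}
  [Fact p.Prime] {π : O} (hπ : Irreducible π) (hk : Nat.card (ResidueField O) = p ^ h)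

theorem ramificationIndex_eq_one {e : ℕ} (he : IsDiscreteValuationRing.addVal O (p : O) = e)
    (hk : Nat.card (ResidueField O) = p ^ h)
    (ψ : O ≃+* WittVector p (ResidueField O)) : e = 1 := by
  have := charP_of_card hk
  have := finite_of_card_eq_pow hk
  have hp : Irreducible (p : O) := by
    rw [← MulEquiv.irreducible_iff ψ, map_natCast]
    exact WittVector.irreducible p
  rw [IsDiscreteValuationRing.addVal_uniformizer hp] at he
  exact_mod_cast he.symm

theorem residueDegree_eq_one {k : Type*} (hk : Nat.card k = p ^ h) (ψ : k ≃ ZMod p) : h = 1 := by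
  rw [Nat.card_congr ψ, Nat.card_zmod] at hk
  exact (Nat.pow_right_injective (Fact.out : p.Prime).two_le ((pow_one p).trans hk)).symm

theorem drinfeldO₀_eq_mk_coeff (hh : h = 1) (A : CommAlgCat.{u} (ResidueField O))
    (x : WittVector p A) : ((drinfeldO₀ hk).app A).hom x = ⟨x.coeff⟩ := by
  subst hh
  exact RamWitt.ext (funext fun n => (coeff_drinfeldO₀ hk A x n).trans (pow_one _))

variable [IsAdicComplete (maximalIdeal O) O]

theorem isIso_toRamTensor (hh : h = 1) : IsIso (toRamTensor hπ hk) := by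
  refine isIso_of_bijective_app _ fun A =>
    TensorRing.map_bijective (drinfeldO₀_scalar hk A) ?_
  rw [funext (drinfeldO₀_eq_mk_coeff hk hh A)]
  exact Function.bijective_iff_has_inverse.2
    ⟨fun y => WittVector.mk p y.coeff, fun _ => rfl, fun _ => rfl⟩

variable [CharZero O]

theorem embO₀_bijective (he : IsDiscreteValuationRing.addVal O (p : O) = (1 : ℕ)) :
    Function.Bijective (embO₀ hπ hk) := by
  have hb := (sum_embO₀_mul_pow_bijective hπ hk he).comp (Equiv.funUnique (Fin 1) _).symm.bijective
  convert hb using 1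
  funext x
  simp

theorem isIso_toGreenberg (he : IsDiscreteValuationRing.addVal O (p : O) = (1 : ℕ)) :
    IsIso (toGreenberg hπ hk) :=
  isIso_of_bijective_app _ fun _ => TensorRing.inl_bijective (embO₀_bijective hπ hk he)

theorem isSpec_ker_r_unram (he : IsDiscreteValuationRing.addVal O (p : O) = (1 : ℕ)) :
    IsSpec (ker (r hπ hk)) (UnramRing (ResidueField O) p h) :=
  ((coordsKerR hπ hk he).reindex (m' := fun n => p ^ (n * (h - 1)))
    (Equiv.prodUnique ℕ (Fin 1)).symm fun n => by simp).isSpec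

theorem isSpec_ker_r_ram (hh : h = 1) {e : ℕ}
    (he : IsDiscreteValuationRing.addVal O (p : O) = e) :
    IsSpec (ker (r hπ hk)) (RamRing (ResidueField O) p e) := by
  have hm (j : ℕ × Fin e) :
      p ^ (j.1 * (e - 1) + (j.2 : ℕ)) = p ^ (j.1 * (h * e - 1) + h * (j.2 : ℕ)) := by
    rw [hh, one_mul, one_mul]
  exact ((coordsKerR hπ hk he).reindex (Equiv.refl _) hm).isSpec

end SpecialCases

end RamifiedWitt

theorem mainTheorem6 {O : Type u} [CommRing O] [IsDomain O] [IsDiscreteValuationRing O]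
    [CharZero O] [IsAdicComplete (IsLocalRing.maximalIdeal O) O]
    {p h e : ℕ} [Fact p.Prime] {π : O} (hπ : Irreducible π)
    (hk : Nat.card (IsLocalRing.ResidueField O) = p ^ h)
    (he : IsDiscreteValuationRing.addVal O (p : O) = e) :
    -- (a)
    (Nonempty (O ≃+* WittVector p (IsLocalRing.ResidueField O)) →
      IsIso (RamifiedWitt.toGreenberg hπ hk) ∧
      RamifiedWitt.toGreenberg hπ hk ≫ RamifiedWitt.r hπ hk = RamifiedWitt.drinfeldO hπ hk ∧
      RamifiedWitt.IsSpec (RamifiedWitt.ker (RamifiedWitt.r hπ hk))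
        (RamifiedWitt.UnramRing (IsLocalRing.ResidueField O) p h)) ∧
    -- (b)
    (Nonempty (IsLocalRing.ResidueField O ≃+* ZMod p) →
      (∃ ε : RamifiedWitt.greenberg hπ hk ≅ RamifiedWitt.ramTensor hπ hk,
        (∀ (A : CommAlgCat.{u} (IsLocalRing.ResidueField O)) (x : WittVector p A) (c : O),
          (ε.hom.app A).hom (RamifiedWitt.TensorRing.tmul
              ((RamifiedWitt.wittScalars p (IsLocalRing.ResidueField O)).hom A)
              (RamifiedWitt.embO₀ hπ hk) x c) =
            RamifiedWitt.TensorRing.tmul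
              ((RamifiedWitt.ramWittScalars (RamifiedWitt.wittDatum hk)
                WittVector.constantCoeff).hom A)
              (RamifiedWitt.embO₀ hπ hk) ⟨x.coeff⟩ c) ∧
        ε.hom ≫ RamifiedWitt.uRam hπ hk = RamifiedWitt.r hπ hk) ∧
      RamifiedWitt.IsSpec (RamifiedWitt.ker (RamifiedWitt.r hπ hk))
        (RamifiedWitt.RamRing (IsLocalRing.ResidueField O) p e)) ∧
    -- (c)
    (RamifiedWitt.IsSpec (RamifiedWitt.ker (RamifiedWitt.drinfeldO₀ hk))
        (RamifiedWitt.UnramRing (IsLocalRing.ResidueField O) p h) ∧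
      RamifiedWitt.IsProInfinitesimal (RamifiedWitt.ker (RamifiedWitt.drinfeldO₀ hk)) ∧
      RamifiedWitt.IsSpec (RamifiedWitt.ker (RamifiedWitt.uRam hπ hk))
        (RamifiedWitt.RamRing (IsLocalRing.ResidueField O) (p ^ h) e) ∧
      RamifiedWitt.IsProInfinitesimal (RamifiedWitt.ker (RamifiedWitt.uRam hπ hk)) ∧
      ∃ (i : RamifiedWitt.power e (RamifiedWitt.ker (RamifiedWitt.drinfeldO₀ hk)) ⟶
            RamifiedWitt.ker (RamifiedWitt.r hπ hk))
        (j : RamifiedWitt.ker (RamifiedWitt.r hπ hk) ⟶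
            RamifiedWitt.ker (RamifiedWitt.uRam hπ hk)),
        RamifiedWitt.IsExtension i j) := by
  refine ⟨?_, ?_, ?_⟩
  · rintro ⟨ψ⟩
    obtain rfl := RamifiedWitt.ramificationIndex_eq_one he hk ψ
    exact ⟨RamifiedWitt.isIso_toGreenberg hπ hk he, RamifiedWitt.toGreenberg_comp_r hπ hk,
      RamifiedWitt.isSpec_ker_r_unram hπ hk he⟩
  · rintro ⟨ψ⟩
    have hh := RamifiedWitt.residueDegree_eq_one hk ψ.toEquiv
    have := RamifiedWitt.isIso_toRamTensor hπ hk hh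
    refine ⟨⟨asIso (RamifiedWitt.toRamTensor hπ hk), fun A x c => ?_,
      RamifiedWitt.toRamTensor_comp_uRam hπ hk⟩, RamifiedWitt.isSpec_ker_r_ram hπ hk hh he⟩
    refine (RamifiedWitt.TensorRing.map_tmul _ (RamifiedWitt.drinfeldO₀_scalar hk A) x c).trans ?_
    rw [RamifiedWitt.drinfeldO₀_eq_mk_coeff hk hh]
  · exact ⟨(RamifiedWitt.coordsKerDrinfeldO₀ hk).isSpec,
      RamifiedWitt.isProInfinitesimal_ker_drinfeldO₀ hk,
      (RamifiedWitt.coordsKerURam hπ hk he).isSpec,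
      RamifiedWitt.isProInfinitesimal_ker_uRam hπ hk he,
      RamifiedWitt.exists_isExtension_ker hπ hk he⟩
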